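/- **Setting.** Let $\mathcal A$ be a Banach space over $\Bbbk\in\{\mathbb R,\mathbb C\}$ with a continuous (conjugate-)linear involution. All Hilbert spaces are over $\Bbbk$, and $\mathcal B(E)$ denotes the bounded operators on $E$. All tensor products are completed projective tensor products, and $\mathcal A\otimes\mathcal B(E)$ carries the involution $(a\otimes Z)^*=a^*\otimes Z^*$. Write $W^*XV$ for $(I_{\mathcal A}\otimes W^*)X(I_{\mathcal A}\otimes V)$. For every Hilbert space $E$ let $D(E)\subseteq\mathcal A\otimes\mathcal B(E)$ be a set of self-adjoint elements with $0\in D(E)$, and let $F:D(E)\to\mathcal B(E)$ be such that - $D(E)\oplus D(K)\subseteq D(E\oplus K)$ and $F(X\oplus Y)=F(X)\oplus F(Y)$; - $F(W^*XW)\ge W^*F(X)W$ for every isometry $W:E\to K$ and every $X\in D(K)$ with $W^*XW\in D(E)$; - $F(X)$ is positive and invertible for every $X\in D(E)$. Let $\mathrm{hypo}(F)(E)=\{(Y,X)\in\mathcal B(E)\times D(E):Y\le F(X)\}$. Let $\mathrm{co}^{\mathrm{mat}}$ denote the matrix convex hull, $\mathrm{co}^{\mathrm{mat}}(D)(E)=\{V^*XV: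 X\in D(K),\ V:E\to K\text{ an isometry},\ K\text{ a Hilbert space}\}$, and similarly for pairs, with $V^*(Y,X)V=(V^*YV,V^*XV)$. Interiors are taken in the real Banach space of self-adjoint elements. Assume that $\mathrm{co}^{\mathrm{mat}}(D)(E)$ has nonempty interior for each $E$. For $\Phi\in\mathcal B(N)^*\otimes\mathcal B(E)$ and $W,V\in\mathcal B(N,E)$ let $\langle W,\Phi V\rangle=W^*\Phi V$ be the scalar determined linearly and continuously by $W^*(\tau\otimes Z)V=\tau(W^*ZV)$. Write $\Phi\ge0$ if this form is hermitian and positive semidefinite. Let $vv^*\in\mathcal B(N)^*$ be the functional $Z\mapsto v^*Zv$. For a bounded $\Lambda:\mathcal A\to\mathcal B(N)^*$ and $X\in\mathcal A\otimes\mathcal B(E)$ write $\Lambda(X)=(\Lambda\otimes I)(X)\in\mathcal B(N)^*\otimes\mathcal B(E)$; in (a), $\Lambda(A)$ denotes the scalar $I_N^*\Lambda(A)I_N$, i.e. $\sum\Lambda(a_i)(Z_i)$ for $A=\sum a_i\otimes Z_i$. Completely bounded means bounded on all levels $E$ with a bound independent of $E$. **Proposition.** Let $N$ be a Hilbert space,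 let $A\in D(N)$ be an interior point of $\mathrm{co}^{\mathrm{mat}}(D)(N)$, and let $v\in N$ be a unit vector. Then there are $T\in\mathcal B(N)^*$ with $T\ge0$ and a self-adjoint completely bounded linear map $\Lambda:\mathcal A\to\mathcal B(N)^*$ such that the affine map $L:\mathcal B(E)\times(\mathcal A\otimes\mathcal B(E))\to\mathcal B(N)^*\otimes\mathcal B(E)$, $$L(Y,X)=T\otimes I_E-vv^*\otimes Y+\Lambda(X),$$ is completely bounded and satisfies the following. - (a) $T(I_N)=v^*F(A)v-\Lambda(A)$. There is $\epsilon>0$ with $(1+\epsilon)A\in\mathrm{co}^{\mathrm{mat}}(D)(N)$, and for every such $\epsilon$ and every $Y$ with $(Y,(1+\epsilon)A)\in\mathrm{co}^{\mathrm{mat}}(\mathrm{hypo}(F))(N)$ one has $$-\Lambda(A)\le\frac{v^*F(A)v-v^*Yv}{\epsilon};$$ in particular this holds with $Y=F((1+\epsilon)A)$ if $(1+\epsilon)A\in D(N)$. - (b) $L(Y,X)\ge0$ for every $E$ and all $(Y,X)\in\mathrm{hypo}(F)(E)$. - (c) $\gamma^*L(F(A),A)\gamma=0$ for $\gamma=I_N$.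 - (d) For every $E$ and every $X$ in the interior of $\mathrm{co}^{\mathrm{mat}}(D)(E)$ there is $\epsilon>0$ such that $\langle V,L(0,X)V\rangle\ge\epsilon\,T(V^*V)$ for all $V\in\mathcal B(N,E)$. Moreover, for every $E$ for which $0$ is an interior point of $\mathrm{co}^{\mathrm{mat}}(D)(E)$ there is a constant $C$ such that $|\langle W,L(Y,X)V\rangle|\le C(1+\|Y\|+\|X\|)\,T(W^*W)^{1/2}T(V^*V)^{1/2}$ for all self-adjoint $Y,X$ and all $W,V\in\mathcal B(N,E)$. Thus $L(Y,X)$ defines a bounded self-adjoint operator on the Hilbert space completion of $\mathcal B(N,E)$ with respect to $\langle W,V\rangle_T=T(W^*V)$, and by density (b) and (d) hold there. -/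

import Mathlib

open scoped TensorProduct ComplexConjugate

universe u w

set_option linter.unusedSectionVars false

noncomputable section

namespace SepPencil

/-! ### The projective tensor product of two normed spaces -/

section Projective

variable (𝕜 : Type*) [RCLike 𝕜] (A B : Type*)
  [NormedAddCommGroup A] [NormedSpace 𝕜 A] [NormedAddCommGroup B] [NormedSpace 𝕜 B]

variable {A B}

/-- The element `∑ aᵢ ⊗ bᵢ` represented by a finite list of pairs. -/
def repSum (l : List (A × B)) : A ⊗[𝕜] B :=
  (l.map fun p => (p.1 ⊗ₜ[𝕜] p.2 : A ⊗[𝕜] B)).sum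

/-- The cost `∑ ‖aᵢ‖ ‖bᵢ‖` of a finite list of pairs. -/
def repCost (l : List (A × B)) : ℝ := (l.map fun p => ‖p.1‖ * ‖p.2‖).sum

/-- The projective norm: the infimum of `∑ ‖aᵢ‖ ‖bᵢ‖` over all representations
`u = ∑ aᵢ ⊗ bᵢ`. -/
def projNorm (u : A ⊗[𝕜] B) : ℝ :=
  ⨅ l : {l : List (A × B) // repSum 𝕜 l = u}, repCost l.1

lemma repCost_nonneg (l : List (A × B)) : 0 ≤ repCost l := by
  refine List.sum_nonneg fun x hx => ?_
  obtain ⟨p, -, rfl⟩ := List.mem_map.1 hx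
  positivity

lemma repSum_append (l m : List (A × B)) :
    repSum 𝕜 (l ++ m) = repSum 𝕜 l + repSum 𝕜 m := by
  unfold repSum
  rw [List.map_append]
  exact List.sum_append

lemma repCost_append (l m : List (A × B)) : repCost (l ++ m) = repCost l + repCost m := by
  simp [repCost]

lemma repSum_smul (c : 𝕜) (l : List (A × B)) :
    repSum 𝕜 (l.map fun p => (c • p.1, p.2)) = c • repSum 𝕜 l := by
  induction l with
  | nil => exact (smul_zero c).symm
  | cons p l ih =>
    have h1 : ∀ (q : A × B) (m : List (A × B)), repSum 𝕜 (q :: m)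
        = q.1 ⊗ₜ[𝕜] q.2 + repSum 𝕜 m := fun q m => rfl
    rw [List.map_cons, h1, h1, ih, smul_add]
    rfl

lemma repCost_smul (c : 𝕜) (l : List (A × B)) :
    repCost (l.map fun p => (c • p.1, p.2)) = ‖c‖ * repCost l := by
  induction l with
  | nil => simp [repCost]
  | cons p l ih =>
    simp only [repCost, List.map_cons, List.sum_cons, norm_smul] at ih ⊢
    rw [ih]; ring

lemma exists_rep (u : A ⊗[𝕜] B) : ∃ l : List (A × B), repSum 𝕜 l = u := by
  refine TensorProduct.induction_on (motive := fun u : A ⊗[𝕜] B =>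
    ∃ l : List (A × B), repSum 𝕜 l = u) u ⟨[], rfl⟩ (fun a b => ⟨[(a, b)], ?_⟩) ?_
  · exact add_zero (a ⊗ₜ[𝕜] b)
  · rintro _ _ ⟨l, rfl⟩ ⟨m, rfl⟩
    exact ⟨l ++ m, repSum_append 𝕜 l m⟩

instance (u : A ⊗[𝕜] B) : Nonempty {l : List (A × B) // repSum 𝕜 l = u} :=
  let ⟨l, hl⟩ := exists_rep 𝕜 u
  ⟨⟨l, hl⟩⟩

lemma projNorm_nonneg (u : A ⊗[𝕜] B) : 0 ≤ projNorm 𝕜 u :=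
  Real.iInf_nonneg fun l => repCost_nonneg l.1

lemma projNorm_le (l : List (A × B)) : projNorm 𝕜 (repSum 𝕜 l) ≤ repCost l :=
  ciInf_le (f := fun m : {m : List (A × B) // repSum 𝕜 m = repSum 𝕜 l} => repCost m.1)
    ⟨0, by rintro _ ⟨m, rfl⟩; exact repCost_nonneg m.1⟩ ⟨l, rfl⟩

lemma projNorm_add_le (u v : A ⊗[𝕜] B) :
    projNorm 𝕜 (u + v) ≤ projNorm 𝕜 u + projNorm 𝕜 v := by
  refine le_ciInf_add_ciInf fun l m => ?_
  have h := projNorm_le 𝕜 (l.1 ++ m.1)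
  rwa [repSum_append, l.2, m.2, repCost_append] at h

lemma projNorm_smul_le (c : 𝕜) (u : A ⊗[𝕜] B) :
    projNorm 𝕜 (c • u) ≤ ‖c‖ * projNorm 𝕜 u := by
  unfold projNorm
  rw [Real.mul_iInf_of_nonneg (norm_nonneg c)]
  refine le_ciInf fun l => ?_
  have h := projNorm_le 𝕜 (l.1.map fun p => (c • p.1, p.2))
  rwa [repSum_smul, l.2, repCost_smul] at h

variable (A B) in
/-- The projective norm as a seminorm. -/
def projSeminorm : Seminorm 𝕜 (A ⊗[𝕜] B) :=
  Seminorm.ofSMulLE (projNorm 𝕜)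
    (le_antisymm (by have h := projNorm_le 𝕜 ([] : List (A × B)); simp only [repSum, repCost, List.map_nil, List.sum_nil] at h; exact h)
      (projNorm_nonneg 𝕜 _))
    (projNorm_add_le 𝕜) (projNorm_smul_le 𝕜)

/-- The algebraic tensor product carries the projective norm. -/
instance instSeminormedTensor : SeminormedAddCommGroup (A ⊗[𝕜] B) :=
  (projSeminorm 𝕜 A B).toAddGroupSeminorm.toSeminormedAddCommGroup

instance instNormedSpaceTensor : NormedSpace 𝕜 (A ⊗[𝕜] B) where
  norm_smul_le c u := projNorm_smul_le 𝕜 c u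

lemma norm_eq_projNorm (u : A ⊗[𝕜] B) : ‖u‖ = projNorm 𝕜 u := rfl

variable (A B) in
/-- The projective tensor product `A ⊗ B` of two Banach spaces: the completion of the algebraic
tensor product in the projective norm. -/
abbrev ProjTensor : Type _ := UniformSpace.Completion (A ⊗[𝕜] B)

/-- An additive map that is bounded on elementary tensors by `C ‖a‖ ‖b‖` is bounded by `C` in the
projective norm. -/
lemma norm_le_of_tmul {G : Type*} [SeminormedAddCommGroup G] (f : A ⊗[𝕜] B →+ G) (C : ℝ)
    (hf : ∀ (a : A) (b : B), ‖f (a ⊗ₜ[𝕜] b : A ⊗[𝕜] B)‖ ≤ C * (‖a‖ * ‖b‖)) (hC : 0 ≤ C)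
    (u : A ⊗[𝕜] B) : ‖f u‖ ≤ C * ‖u‖ := by
  rw [norm_eq_projNorm, projNorm, Real.mul_iInf_of_nonneg hC]
  have key : ∀ l : List (A × B), ‖f (repSum 𝕜 l)‖ ≤ C * repCost l := by
    intro l
    induction l with
    | nil =>
      have : f (repSum 𝕜 []) = 0 := map_zero f
      simp [this, repCost]
    | cons p l ih =>
      have h1 : repSum 𝕜 (p :: l) = p.1 ⊗ₜ[𝕜] p.2 + repSum 𝕜 l := rfl
      have h2 : repCost (p :: l) = ‖p.1‖ * ‖p.2‖ + repCost l := by simp [repCost]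
      rw [h1, h2, map_add, mul_add]
      exact (norm_add_le _ _).trans (add_le_add (hf _ _) ih)
  refine le_ciInf fun ⟨l, hl⟩ => ?_
  have h := key l
  rwa [hl] at h

variable (A B) in
/-- The canonical bounded bilinear map `(a, b) ↦ a ⊗ b` into the projective tensor product. -/
def tmulL : A →L[𝕜] B →L[𝕜] ProjTensor 𝕜 A B :=
  LinearMap.mkContinuous₂
    ((TensorProduct.mk 𝕜 A B).compr₂
      (UniformSpace.Completion.toComplₗᵢ
        (𝕜 := 𝕜) (E := A ⊗[𝕜] B)).toLinearMap) 1 fun a b => by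
    have h := projNorm_le 𝕜 [(a, b)]
    have h1 : repSum 𝕜 [(a, b)] = (a ⊗ₜ[𝕜] b : A ⊗[𝕜] B) := add_zero _
    rw [h1] at h
    have h2 : repCost [(a, b)] = ‖a‖ * ‖b‖ := by simp [repCost]
    rw [h2] at h
    rw [one_mul]
    exact (UniformSpace.Completion.norm_coe _).le.trans h

lemma tmulL_apply (a : A) (b : B) :
    tmulL 𝕜 A B a b = ((a ⊗ₜ[𝕜] b : A ⊗[𝕜] B) : ProjTensor 𝕜 A B) := rfl

variable {𝕜}

/-- The bounded linear map on the algebraic tensor product induced by a bounded bilinear map. -/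
def liftAlg {G : Type*} [NormedAddCommGroup G] [NormedSpace 𝕜 G]
    (f : A →L[𝕜] B →L[𝕜] G) : A ⊗[𝕜] B →L[𝕜] G :=
  (TensorProduct.lift (ContinuousLinearMap.toLinearMap₁₂ f)).mkContinuous ‖f‖ fun u =>
    norm_le_of_tmul 𝕜 (TensorProduct.lift (ContinuousLinearMap.toLinearMap₁₂ f)).toAddMonoidHom
      ‖f‖ (fun a b => (f.le_opNorm₂ a b).trans_eq (mul_assoc _ _ _)) (norm_nonneg f) u

/-- The bounded linear map on the projective tensor product induced by a bounded bilinear map: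
the unique one with `a ⊗ b ↦ f a b`. -/
def lift {G : Type*} [NormedAddCommGroup G] [NormedSpace 𝕜 G] [CompleteSpace G]
    (f : A →L[𝕜] B →L[𝕜] G) : ProjTensor 𝕜 A B →L[𝕜] G :=
  (liftAlg f).extend (UniformSpace.Completion.toComplL (𝕜 := 𝕜) (E := A ⊗[𝕜] B))

lemma lift_coe {G : Type*} [NormedAddCommGroup G] [NormedSpace 𝕜 G] [CompleteSpace G]
    (f : A →L[𝕜] B →L[𝕜] G) (u : A ⊗[𝕜] B) :
    lift f (u : ProjTensor 𝕜 A B) = liftAlg f u :=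
  ContinuousLinearMap.extend_eq (liftAlg f)
    (e := UniformSpace.Completion.toComplL (𝕜 := 𝕜) (E := A ⊗[𝕜] B))
    UniformSpace.Completion.denseRange_coe
    (UniformSpace.Completion.isUniformInducing_coe _) u

lemma lift_tmul {G : Type*} [NormedAddCommGroup G] [NormedSpace 𝕜 G] [CompleteSpace G]
    (f : A →L[𝕜] B →L[𝕜] G) (a : A) (b : B) : lift f (tmulL 𝕜 A B a b) = f a b := by
  rw [tmulL_apply, lift_coe]
  rfl

/-- `I_A ⊗ φ` for a bounded linear map `φ`. -/
def mapRight (A : Type*) [NormedAddCommGroup A] [NormedSpace 𝕜 A]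
    {B' : Type*} [NormedAddCommGroup B'] [NormedSpace 𝕜 B']
    (φ : B →L[𝕜] B') : ProjTensor 𝕜 A B →L[𝕜] ProjTensor 𝕜 A B' :=
  lift (((ContinuousLinearMap.compL 𝕜 B B' (ProjTensor 𝕜 A B')).flip φ).comp (tmulL 𝕜 A B'))

/-- `Λ ⊗ I_B` for a bounded linear map `Λ`. -/
def mapLeft (B : Type*) [NormedAddCommGroup B] [NormedSpace 𝕜 B]
    {A' : Type*} [NormedAddCommGroup A'] [NormedSpace 𝕜 A']
    (Λ : A →L[𝕜] A') : ProjTensor 𝕜 A B →L[𝕜] ProjTensor 𝕜 A' B :=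
  lift ((tmulL 𝕜 A' B).comp Λ)

lemma mapRight_tmul {B' : Type*} [NormedAddCommGroup B'] [NormedSpace 𝕜 B']
    (φ : B →L[𝕜] B') (a : A) (b : B) :
    mapRight A φ (tmulL 𝕜 A B a b) = tmulL 𝕜 A B' a (φ b) := by
  simp [mapRight, lift_tmul]

lemma mapLeft_tmul {A' : Type*} [NormedAddCommGroup A'] [NormedSpace 𝕜 A']
    (Λ : A →L[𝕜] A') (a : A) (b : B) :
    mapLeft B Λ (tmulL 𝕜 A B a b) = tmulL 𝕜 A' B (Λ a) b := by
  simp [mapLeft, lift_tmul]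

variable [StarAddMonoid A] [StarModule 𝕜 A] [ContinuousStar A]
  [StarAddMonoid B] [StarModule 𝕜 B] [ContinuousStar B]

/-- The involution `a ⊗ b ↦ a* ⊗ b*` of the algebraic tensor product. -/
def adjAlg : A ⊗[𝕜] B →L⋆[𝕜] A ⊗[𝕜] B :=
  (starLinearEquiv 𝕜 (A := A ⊗[𝕜] B)).toLinearMap.mkContinuousOfExistsBound <| by
    obtain ⟨C, hC, hA⟩ := SemilinearMapClass.bound_of_continuous
      (starLinearEquiv 𝕜 (A := A)) continuous_star
    obtain ⟨C', hC', hB⟩ := SemilinearMapClass.bound_of_continuous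
      (starLinearEquiv 𝕜 (A := B)) continuous_star
    refine ⟨C * C', norm_le_of_tmul 𝕜
      (starLinearEquiv 𝕜 (A := A ⊗[𝕜] B)).toLinearMap.toAddMonoidHom (C * C')
      (fun a b => ?_) (by positivity)⟩
    have h := projNorm_le 𝕜 [(star a, star b)]
    have h1 : repSum 𝕜 [(star a, star b)] = star a ⊗ₜ[𝕜] star b := add_zero _
    have h2 : repCost [(star a, star b)] = ‖star a‖ * ‖star b‖ := by simp [repCost]
    rw [h1, h2] at h
    refine h.trans ((mul_le_mul (hA a) (hB b) (norm_nonneg _) (by positivity)).trans_eq ?_)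
    ring

/-- The involution `a ⊗ b ↦ a* ⊗ b*` of the projective tensor product (conjugate linear,
continuous). -/
def adj : ProjTensor 𝕜 A B →L⋆[𝕜] ProjTensor 𝕜 A B :=
  ((UniformSpace.Completion.toComplL (𝕜 := 𝕜) (E := A ⊗[𝕜] B)).comp adjAlg).extend
    (UniformSpace.Completion.toComplL (𝕜 := 𝕜) (E := A ⊗[𝕜] B))

lemma adj_coe (u : A ⊗[𝕜] B) :
    adj (u : ProjTensor 𝕜 A B) = ((star u : A ⊗[𝕜] B) : ProjTensor 𝕜 A B) :=
  ContinuousLinearMap.extend_eq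
    ((UniformSpace.Completion.toComplL (𝕜 := 𝕜) (E := A ⊗[𝕜] B)).comp adjAlg)
    (e := UniformSpace.Completion.toComplL (𝕜 := 𝕜) (E := A ⊗[𝕜] B))
    UniformSpace.Completion.denseRange_coe
    (UniformSpace.Completion.isUniformInducing_coe _) u

lemma adj_tmul (a : A) (b : B) :
    adj (tmulL 𝕜 A B a b) = tmulL 𝕜 A B (star a) (star b) := by
  rw [tmulL_apply, adj_coe]
  rfl

end Projective

/-! ### Operators, direct sums, compressions -/

section Operators

variable {𝕜 : Type*} [RCLike 𝕜]
  {E : Type*} [NormedAddCommGroup E] [InnerProductSpace 𝕜 E] [CompleteSpace E]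
  {K : Type*} [NormedAddCommGroup K] [InnerProductSpace 𝕜 K] [CompleteSpace K]

/-- The map `Z ↦ W* Z V` from `B(K)` to `B(E)`, for bounded `W, V : E → K`. -/
def sandwich (W V : E →L[𝕜] K) : (K →L[𝕜] K) →L[𝕜] (E →L[𝕜] E) :=
  (ContinuousLinearMap.compL 𝕜 E K E W.adjoint).comp
    ((ContinuousLinearMap.compL 𝕜 E K K).flip V)

lemma sandwich_apply (W V : E →L[𝕜] K) (Z : K →L[𝕜] K) :
    sandwich W V Z = W.adjoint ∘L Z ∘L V := rfl

/-- The direct sum `S ⊕ T` of operators on the Hilbert sum `E ⊕ K`. -/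
def opSum (S : E →L[𝕜] E) (T : K →L[𝕜] K) : WithLp 2 (E × K) →L[𝕜] WithLp 2 (E × K) :=
  sandwich (WithLp.fstL 2 𝕜 E K) (WithLp.fstL 2 𝕜 E K) S
    + sandwich (WithLp.sndL 2 𝕜 E K) (WithLp.sndL 2 𝕜 E K) T

variable {A : Type*} [NormedAddCommGroup A] [NormedSpace 𝕜 A]

/-- The compression `(I_A ⊗ W*) X (I_A ⊗ W)` of `X ∈ A ⊗ B(K)` to `A ⊗ B(E)`. -/
def compress (W : E →L[𝕜] K) :
    ProjTensor 𝕜 A (K →L[𝕜] K) →L[𝕜] ProjTensor 𝕜 A (E →L[𝕜] E) :=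
  mapRight A (sandwich W W)

/-- The direct sum `X ⊕ Y ∈ A ⊗ B(E ⊕ K)` of `X ∈ A ⊗ B(E)` and `Y ∈ A ⊗ B(K)`. -/
def tensorSum (X : ProjTensor 𝕜 A (E →L[𝕜] E)) (Y : ProjTensor 𝕜 A (K →L[𝕜] K)) :
    ProjTensor 𝕜 A (WithLp 2 (E × K) →L[𝕜] WithLp 2 (E × K)) :=
  compress (WithLp.fstL 2 𝕜 E K) X + compress (WithLp.sndL 2 𝕜 E K) Y

/-- The interior of a set `S` of self-adjoint elements of `A ⊗ B(E)`, taken in the real Banach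
space of all self-adjoint elements. -/
def saInterior [StarAddMonoid A] [StarModule 𝕜 A] [ContinuousStar A]
    (S : Set (ProjTensor 𝕜 A (E →L[𝕜] E))) : Set (ProjTensor 𝕜 A (E →L[𝕜] E)) :=
  {X | adj X = X ∧ ∃ ρ > 0, ∀ Z, adj Z = Z → ‖Z - X‖ < ρ → Z ∈ S}

end Operators

/-! ### Graded sets, functions on them, hypographs and matrix convex hulls -/

section Families

variable (𝕜 : Type*) [RCLike 𝕜] (A : Type w) [NormedAddCommGroup A] [NormedSpace 𝕜 A]

/-- A collection `(D(E))` of sets `D(E) ⊆ A ⊗ B(E)`, one for each Hilbert space `E`. -/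
abbrev SetFamily : Type _ :=
  ∀ (E : Type u) [NormedAddCommGroup E] [InnerProductSpace 𝕜 E] [CompleteSpace E],
    Set (ProjTensor 𝕜 A (E →L[𝕜] E))

/-- A collection of functions with values in `B(E)`, one for each Hilbert space `E`. They are
total on `A ⊗ B(E)`; only the values on the domain `D(E)` are ever used. -/
abbrev FunFamily : Type _ :=
  ∀ (E : Type u) [NormedAddCommGroup E] [InnerProductSpace 𝕜 E] [CompleteSpace E],
    ProjTensor 𝕜 A (E →L[𝕜] E) → (E →L[𝕜] E)

variable {𝕜 A}

/-- All elements of all `D(E)` are self-adjoint. -/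
def IsSelfAdjointFamily [StarAddMonoid A] [StarModule 𝕜 A] [ContinuousStar A]
    (D : SetFamily.{u} 𝕜 A) : Prop :=
  ∀ (E : Type u) [NormedAddCommGroup E] [InnerProductSpace 𝕜 E] [CompleteSpace E],
    ∀ X ∈ D E, adj X = X

/-- `D(E) ⊕ D(K) ⊆ D(E ⊕ K)`. -/
def ClosedUnderSums (D : SetFamily.{u} 𝕜 A) : Prop :=
  ∀ (E : Type u) [NormedAddCommGroup E] [InnerProductSpace 𝕜 E] [CompleteSpace E]
    (K : Type u) [NormedAddCommGroup K] [InnerProductSpace 𝕜 K] [CompleteSpace K],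
    ∀ X ∈ D E, ∀ Y ∈ D K, tensorSum X Y ∈ D (WithLp 2 (E × K))

/-- `F(X ⊕ Y) = F(X) ⊕ F(Y)`. -/
def PreservesSums (D : SetFamily.{u} 𝕜 A) (F : FunFamily.{u} 𝕜 A) : Prop :=
  ∀ (E : Type u) [NormedAddCommGroup E] [InnerProductSpace 𝕜 E] [CompleteSpace E]
    (K : Type u) [NormedAddCommGroup K] [InnerProductSpace 𝕜 K] [CompleteSpace K],
    ∀ X ∈ D E, ∀ Y ∈ D K, F (WithLp 2 (E × K)) (tensorSum X Y) = opSum (F E X) (F K Y)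

/-- For every isometry `W : E → K` and `X ∈ D(K)` with `W* X W ∈ D(E)`:
`F(W* X W) ≥ W* F(X) W`. -/
def IsJensen (D : SetFamily.{u} 𝕜 A) (F : FunFamily.{u} 𝕜 A) : Prop :=
  ∀ (E : Type u) [NormedAddCommGroup E] [InnerProductSpace 𝕜 E] [CompleteSpace E]
    (K : Type u) [NormedAddCommGroup K] [InnerProductSpace 𝕜 K] [CompleteSpace K]
    (W : E →ₗᵢ[𝕜] K), ∀ X ∈ D K, compress W.toContinuousLinearMap X ∈ D E →
      sandwich W.toContinuousLinearMap W.toContinuousLinearMap (F K X)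
        ≤ F E (compress W.toContinuousLinearMap X)

/-- `F(X)` is positive and invertible for all `X` in the domain. -/
def IsPositiveOn (D : SetFamily.{u} 𝕜 A) (F : FunFamily.{u} 𝕜 A) : Prop :=
  ∀ (E : Type u) [NormedAddCommGroup E] [InnerProductSpace 𝕜 E] [CompleteSpace E],
    ∀ X ∈ D E, IsStrictlyPositive (F E X)

/-- The hypograph `{(Y, X) : X ∈ D(E), Y ≤ F(X)}` at level `E`. -/
def hypo (D : SetFamily.{u} 𝕜 A) (F : FunFamily.{u} 𝕜 A)
    (E : Type u) [NormedAddCommGroup E] [InnerProductSpace 𝕜 E] [CompleteSpace E] :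
    Set ((E →L[𝕜] E) × ProjTensor 𝕜 A (E →L[𝕜] E)) :=
  {p | p.2 ∈ D E ∧ p.1 ≤ F E p.2}

/-- The matrix convex hull of `D` at level `E`: all `V* X V` with `X ∈ D(K)`, `K` a Hilbert space
and `V : E → K` an isometry. -/
def hull (D : SetFamily.{u} 𝕜 A)
    (E : Type u) [NormedAddCommGroup E] [InnerProductSpace 𝕜 E] [CompleteSpace E] :
    Set (ProjTensor 𝕜 A (E →L[𝕜] E)) :=
  {Z | ∃ (K : Type u) (_ : NormedAddCommGroup K) (_ : InnerProductSpace 𝕜 K)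
    (_ : CompleteSpace K) (V : E →ₗᵢ[𝕜] K), ∃ X ∈ D K,
      Z = compress V.toContinuousLinearMap X}

/-- The matrix convex hull of the hypograph at level `E`: all `(V* Y V, V* X V)` with `(Y, X)` in
the hypograph at some level `K` and `V : E → K` an isometry. -/
def hypoHull (D : SetFamily.{u} 𝕜 A) (F : FunFamily.{u} 𝕜 A)
    (E : Type u) [NormedAddCommGroup E] [InnerProductSpace 𝕜 E] [CompleteSpace E] :
    Set ((E →L[𝕜] E) × ProjTensor 𝕜 A (E →L[𝕜] E)) :=
  {q | ∃ (K : Type u) (_ : NormedAddCommGroup K) (_ : InnerProductSpace 𝕜 K)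
    (_ : CompleteSpace K) (V : E →ₗᵢ[𝕜] K), ∃ p ∈ hypo D F K,
      q = (sandwich V.toContinuousLinearMap V.toContinuousLinearMap p.1,
        compress V.toContinuousLinearMap p.2)}

end Families

/-! ### Functionals on `B(N)` and pencils -/

section Pencils

variable {𝕜 : Type*} [RCLike 𝕜]
  {N : Type u} [NormedAddCommGroup N] [InnerProductSpace 𝕜 N] [CompleteSpace N]
  {A : Type w} [NormedAddCommGroup A] [NormedSpace 𝕜 A]

variable (𝕜 N) in
/-- The Banach space dual `B(N)*`. -/
abbrev OpDual : Type _ := StrongDual 𝕜 (N →L[𝕜] N)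

/-- `0 ≤ T` in `B(N)*`: `T` is hermitian and nonnegative on positive operators (over the complex
numbers the second condition with real values implies the first). -/
def IsPositiveFunctional (T : OpDual 𝕜 N) : Prop :=
  (∀ Z, T (star Z) = conj (T Z)) ∧ ∀ Z, 0 ≤ Z → 0 ≤ RCLike.re (T Z)

/-- `Λ : A → B(N)*` is self-adjoint: `Λ(a*) = Λ(a)*`, where `τ*(Z) = conj (τ(Z*))`. -/
def IsSelfAdjointMap [StarAddMonoid A] (Λ : A →L[𝕜] OpDual 𝕜 N) : Prop :=
  ∀ a Z, Λ (star a) Z = conj (Λ a (star Z))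

/-- The functional `v v* : Z ↦ v* Z v` in `B(N)*`. -/
def vecFunctional (v : N) : OpDual 𝕜 N :=
  (innerSL 𝕜 v).comp (ContinuousLinearMap.apply 𝕜 N v)

lemma vecFunctional_apply (v : N) (Z : N →L[𝕜] N) : vecFunctional v Z = inner 𝕜 v (Z v) := rfl

/-- The amplification `Λ ⊗ I : A ⊗ B(E) → B(N)* ⊗ B(E)` of a bounded `Λ : A → B(N)*`. -/
def amplify (Λ : A →L[𝕜] OpDual 𝕜 N)
    (E : Type u) [NormedAddCommGroup E] [InnerProductSpace 𝕜 E] [CompleteSpace E] :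
    ProjTensor 𝕜 A (E →L[𝕜] E) →L[𝕜] ProjTensor 𝕜 (OpDual 𝕜 N) (E →L[𝕜] E) :=
  mapLeft (𝕜 := 𝕜) (A := A) (A' := OpDual 𝕜 N) (E →L[𝕜] E) Λ

/-- A bounded linear map `Λ : A → B(N)*` is completely bounded: its amplifications
`Λ ⊗ I : A ⊗ B(E) → B(N)* ⊗ B(E)` are bounded uniformly in the Hilbert space `E`. -/
def IsCompletelyBounded (Λ : A →L[𝕜] OpDual 𝕜 N) : Prop :=
  ∃ C : ℝ, ∀ (E : Type u) [NormedAddCommGroup E] [InnerProductSpace 𝕜 E] [CompleteSpace E],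
    ‖amplify Λ E‖ ≤ C

/-- A family of continuous affine maps `(B(E), A ⊗ B(E)) → B(N)* ⊗ B(E)` is completely bounded: the
norms `max (‖L_E(0)‖, ‖linear part of L_E‖)` are bounded uniformly in `E`. -/
def IsCompletelyBoundedAffine
    (L : ∀ (E : Type u) [NormedAddCommGroup E] [InnerProductSpace 𝕜 E] [CompleteSpace E],
      ((E →L[𝕜] E) × ProjTensor 𝕜 A (E →L[𝕜] E)) →ᴬ[𝕜]
        ProjTensor 𝕜 (OpDual 𝕜 N) (E →L[𝕜] E)) : Prop :=
  ∃ C : ℝ, ∀ (E : Type u) [NormedAddCommGroup E] [InnerProductSpace 𝕜 E] [CompleteSpace E],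
    ‖L E‖ ≤ C

/-- The affine pencil `(Y, X) ↦ T ⊗ I_E - v v* ⊗ Y + Λ(X)`, where `Λ(X)` is `(Λ ⊗ I)(X)`. -/
def pencil (T : OpDual 𝕜 N) (v : N) (Λ : A →L[𝕜] OpDual 𝕜 N)
    (E : Type u) [NormedAddCommGroup E] [InnerProductSpace 𝕜 E] [CompleteSpace E] :
    ((E →L[𝕜] E) × ProjTensor 𝕜 A (E →L[𝕜] E)) →ᴬ[𝕜]
      ProjTensor 𝕜 (OpDual 𝕜 N) (E →L[𝕜] E) :=
  ContinuousAffineMap.const 𝕜 _ (tmulL 𝕜 (OpDual 𝕜 N) (E →L[𝕜] E) T 1)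
    + ((amplify Λ E).comp (ContinuousLinearMap.snd 𝕜 _ _)
      - (tmulL 𝕜 (OpDual 𝕜 N) (E →L[𝕜] E) (vecFunctional v)).comp
        (ContinuousLinearMap.fst 𝕜 _ _)).toContinuousAffineMap

lemma pencil_apply (T : OpDual 𝕜 N) (v : N) (Λ : A →L[𝕜] OpDual 𝕜 N)
    (E : Type u) [NormedAddCommGroup E] [InnerProductSpace 𝕜 E] [CompleteSpace E]
    (Y : E →L[𝕜] E) (X : ProjTensor 𝕜 A (E →L[𝕜] E)) :
    pencil T v Λ E (Y, X) = tmulL 𝕜 _ _ T 1 - tmulL 𝕜 _ _ (vecFunctional v) Y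
      + amplify Λ E X := by
  have h : pencil T v Λ E (Y, X) = tmulL 𝕜 _ _ T 1
      + (amplify Λ E X - tmulL 𝕜 _ _ (vecFunctional v) Y) := rfl
  rw [h]; abel

variable {E : Type u} [NormedAddCommGroup E] [InnerProductSpace 𝕜 E] [CompleteSpace E]

/-- The compression `W* Φ V` of `Φ ∈ B(N)* ⊗ B(E)` by operators `W, V : N → E`: the linear
functional with `τ ⊗ Z ↦ τ(W* Z V)`. As a function of `(W, V)` this is the sesquilinear form
`⟨W, Φ V⟩` of `Φ`. -/
def form (W V : N →L[𝕜] E) : ProjTensor 𝕜 (OpDual 𝕜 N) (E →L[𝕜] E) →L[𝕜] 𝕜 :=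
  lift ((ContinuousLinearMap.compL 𝕜 (E →L[𝕜] E) (N →L[𝕜] N) 𝕜).flip (sandwich W V))

lemma form_tmul (W V : N →L[𝕜] E) (τ : OpDual 𝕜 N) (Z : E →L[𝕜] E) :
    form W V (tmulL 𝕜 _ _ τ Z) = τ (W.adjoint ∘L Z ∘L V) :=
  lift_tmul _ _ _

/-- `Φ ≥ 0` for `Φ ∈ B(N)* ⊗ B(E)`: the sesquilinear form `⟨W, Φ V⟩` on `B(N, E)` is hermitian
and positive semidefinite. -/
def IsNonneg (Φ : ProjTensor 𝕜 (OpDual 𝕜 N) (E →L[𝕜] E)) : Prop :=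
  (∀ W V : N →L[𝕜] E, form W V Φ = conj (form V W Φ)) ∧
    ∀ V : N →L[𝕜] E, 0 ≤ RCLike.re (form V V Φ)

/-- The semi-norm square `‖V‖_T² = T(V* V)` on `B(N, E)`. -/
def sqNorm (T : OpDual 𝕜 N) (V : N →L[𝕜] E) : ℝ := RCLike.re (T (V.adjoint ∘L V))

end Pencils

end SepPencil

end

/-! The pencil is a supporting hyperplane of the hypograph at `(F(A), A)`, seen only in the
direction `v`. For all levels `E` and all bounded `V : N → E`, pull the hypograph back to level `N`:
the triples `(Z, V*XV, s)` with `V*V ≤ Z` and `s ≤ ⟨Vv, Y Vv⟩` form a convex cone `hypoCone`. It is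
closed under addition because `D` and `F` respect direct sums (stack `V` and `V'` in a column), and
under positive scaling by replacing `V` with `√c V`.

On the ray through `(1, A)` the height is at most `⟨v, F(A)v⟩`. This is Jensen's inequality for
contractions: complete `V` to an isometry `(V, S)` with `S*S = 1 - V*V`, apply the hypothesis to `X
⊕ 0`, and drop `S*F(0)S ≥ 0` (`sandwich_le_of_contraction`, `le_of_mem_hypoCone`). Since `A` is
interior to the hull, every hermitian pair enters the cone at height zero after a multiple of `(1,
A)` is added (`exists_add_smul_mem_hypoCone`). The M. Riesz extension theorem then gives a hermitian
functional `(T, ℓ)` with value `⟨v, F(A)v⟩` at `(1, A)` that dominates the cone. No topology enters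
the separation: `T` is continuous because it is positive, `ℓ` because it is bounded below near `0`.

Put `Λ(a)(Z) = ℓ(a ⊗ Z)`. The form of the pencil at `(V, V)` is `T(V*V) - ⟨Vv, Y Vv⟩ + ℓ(V*XV)`, so
domination is (b), equality at `V = 1` is (c), and (a) and (d) come from testing domination at
slightly enlarged points. Complete boundedness is automatic for projective tensor norms. -/

noncomputable section

namespace SepPencil

/-! ### Hermitian functionals and Cauchy–Schwarz -/

section General

variable {𝕜 : Type*} [RCLike 𝕜]

/-- A Hahn–Banach type theorem: if `C` is a convex cone in `U × ℝ`, and `r ≤ c t` whenever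
`(c e, r) ∈ C`, then a hermitian functional with value `t` at `e` dominates `C`. -/
theorem exists_hermitian_functional {U : Type*} [AddCommGroup U] [Module 𝕜 U]
    (J : U →ₗ⋆[𝕜] U) (hJ : ∀ x, J (J x) = x) (C : Set (U × ℝ)) (h0 : (0 : U × ℝ) ∈ C)
    (hadd : ∀ p ∈ C, ∀ q ∈ C, p + q ∈ C)
    (hsmul : ∀ c : ℝ, 0 < c → ∀ p ∈ C, (((c : 𝕜) • p.1, c * p.2) : U × ℝ) ∈ C)
    (e : U) (he : J e = e) (hne : e ≠ 0) (t : ℝ)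
    (hle : ∀ c r : ℝ, (((c : 𝕜) • e, r) : U × ℝ) ∈ C → r ≤ c * t)
    (hdense : ∀ x, J x = x → ∃ c s : ℝ, ((x + (c : 𝕜) • e, s) : U × ℝ) ∈ C) :
    ∃ φ : U →ₗ[𝕜] 𝕜, (∀ x, φ (J x) = conj (φ x)) ∧ φ e = (t : 𝕜) ∧
      ∀ p ∈ C, J p.1 = p.1 → p.2 ≤ RCLike.re (φ p.1) := by
  let _ : Module ℝ U := Module.compHom U (algebraMap ℝ 𝕜)
  have hrs : ∀ (c : ℝ) (x : U), c • x = (c : 𝕜) • x := fun c x => rfl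
  have : IsScalarTower ℝ 𝕜 U := ⟨fun c z x => by
    rw [hrs, RCLike.real_smul_eq_coe_mul, mul_smul]⟩
  -- The real-linear projection onto the hermitian elements. Pulling the cone back along it makes
  -- the extended functional vanish on the skew part.
  let R : U →ₗ[ℝ] U :=
    { toFun := fun x => (1 / 2 : ℝ) • (x + J x)
      map_add' := fun x y => by rw [← smul_add, map_add]; congr 1; abel
      map_smul' := fun c x => by
        simp only [hrs, map_smulₛₗ, RCLike.conj_ofReal, RingHom.id_apply, smul_add,
          smul_comm (c : 𝕜)] }
  have hR : ∀ x, J x = x → R x = x := fun x hx => by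
    change (1 / 2 : ℝ) • (x + J x) = x
    rw [hx, ← two_smul ℝ x, smul_smul]; norm_num
  have hRJ : ∀ x, J (R x) = R x := fun x => by
    change J ((1 / 2 : ℝ) • (x + J x)) = (1 / 2 : ℝ) • (x + J x)
    rw [hrs, map_smulₛₗ, RCLike.conj_ofReal, map_add, hJ, add_comm]
  have hR0 : ((R (0 : U × ℝ).1, (0 : U × ℝ).2) : U × ℝ) ∈ C := by
    rw [Prod.fst_zero, map_zero]; exact h0
  let s : PointedCone ℝ (U × ℝ) :=
    { carrier := {p | (R p.1, p.2) ∈ C}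
      add_mem' := fun {p q} hp hq => by
        have := hadd _ hp _ hq
        simpa using this
      zero_mem' := hR0
      smul_mem' := fun c p hp => by
        rcases c with ⟨c, hc⟩
        rcases hc.eq_or_lt with rfl | hc
        · have : ((⟨0, hc⟩ : {c : ℝ // 0 ≤ c}) • p) = 0 := zero_smul ℝ p
          rw [this]; exact hR0
        · have := hsmul c hc _ hp
          have h2 : ((⟨c, hc.le⟩ : {c : ℝ // 0 ≤ c}) • p) = c • p := rfl
          rw [h2]
          change (R (c • p.1), c * p.2) ∈ C
          rw [map_smul]
          exact this }
  have hs : ∀ p, p ∈ s ↔ (R p.1, p.2) ∈ C := fun p => Iff.rfl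
  let i : ℝ × ℝ →ₗ[ℝ] U × ℝ :=
    LinearMap.prodMap (LinearMap.toSpanSingleton ℝ U e) LinearMap.id
  have hi : ∀ c r : ℝ, i (c, r) = (c • e, r) := fun c r => rfl
  have hinj : Function.Injective i := by
    rw [← LinearMap.ker_eq_bot, LinearMap.ker_eq_bot']
    rintro ⟨c, r⟩ h
    rw [hi, Prod.mk_eq_zero, smul_eq_zero] at h
    rw [h.2, h.1.resolve_right hne]; rfl
  obtain ⟨f, hf, hdom⟩ : ∃ f : (U × ℝ) →ₗ.[ℝ] ℝ,
      (∀ x : f.domain, ∃ c r : ℝ, (x : U × ℝ) = (c • e, r) ∧ f x = t * c - r) ∧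
      ∀ c r : ℝ, ∃ x : f.domain, (x : U × ℝ) = (c • e, r) ∧ f x = t * c - r := by
    let l : ℝ × ℝ →ₗ[ℝ] ℝ := t • LinearMap.fst ℝ ℝ ℝ - LinearMap.snd ℝ ℝ ℝ
    let ι := LinearEquiv.ofInjective i hinj
    refine ⟨⟨LinearMap.range i, l ∘ₗ ι.symm.toLinearMap⟩, fun x => ?_, fun c r => ?_⟩
    · obtain ⟨⟨c, r⟩, hc⟩ := ι.surjective x
      refine ⟨c, r, ?_, ?_⟩
      · rw [← hc]; rfl
      · rw [← hc]
        change l (ι.symm (ι (c, r))) = _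
        rw [LinearEquiv.symm_apply_apply]; rfl
    · refine ⟨ι (c, r), rfl, ?_⟩
      change l (ι.symm (ι (c, r))) = _
      rw [LinearEquiv.symm_apply_apply]; rfl
  -- The functional `(c e, r) ↦ t c - r` is nonnegative on the cone by `hle`; the absorption
  -- condition of the M. Riesz theorem is `hdense`.
  obtain ⟨g, hg, hgs⟩ := riesz_extension s f (by
    intro x hx
    obtain ⟨c, r, hx', hfx⟩ := hf x
    rw [hfx]
    rw [hs, hx'] at hx
    simp only at hx
    rw [hR _ (by rw [hrs, map_smulₛₗ, RCLike.conj_ofReal, he])] at hx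
    have := hle c r hx
    linarith) (by
    rintro ⟨x, r⟩
    obtain ⟨c, q, h⟩ := hdense (R x) (hRJ x)
    obtain ⟨y, hy, -⟩ := hdom c (q - r)
    refine ⟨y, ?_⟩
    rw [hs, hy]
    simp only [Prod.mk_add_mk, map_add, map_smul, hR e he, sub_add_cancel]
    rw [add_comm]
    exact h)
  have hge : ∀ c r : ℝ, g (c • e, r) = t * c - r := fun c r => by
    obtain ⟨y, hy, hfy⟩ := hdom c r
    rw [← hy, hg, hfy]
  let G : U →ₗ[ℝ] ℝ := g ∘ₗ LinearMap.inl ℝ U ℝ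
  have hsplit : ∀ x r, g (x, r) = G x - r := fun x r => by
    have h1 : g ((x, r) : U × ℝ) = g ((x, 0) : U × ℝ) + g (((0 : ℝ) • e, r) : U × ℝ) := by
      rw [← map_add]; simp
    rw [h1, hge]; simp [G, sub_eq_add_neg]
  -- Applied to `x` and `-x` this gives `G = 0` on the kernel of `R`, which contains `J x - x`.
  have hGker : ∀ x, R x = 0 → 0 ≤ G x := fun x hx => by
    have := hgs (x, 0) (by rw [hs, hx]; exact h0)
    rwa [hsplit, sub_zero] at this
  have hGJ : ∀ x, G (J x) = G x := fun x => by
    have h1 : R (J x - x) = 0 := by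
      change (1 / 2 : ℝ) • ((J x - x) + J (J x - x)) = 0
      rw [map_sub, hJ]; simp
    have h2 := hGker _ h1
    have h3 := hGker (-(J x - x)) (by rw [map_neg, h1, neg_zero])
    rw [map_neg] at h3
    rw [map_sub] at h2 h3
    linarith
  let φ : U →ₗ[𝕜] 𝕜 := Module.Dual.extendRCLike (𝕜 := 𝕜) (F := U) G
  have hre : ∀ x, RCLike.re (φ x) = G x := fun x => Module.Dual.re_extendRCLike_apply G x
  have him : ∀ x, RCLike.im (φ x) = - G ((RCLike.I : 𝕜) • x) :=
    fun x => Module.Dual.im_extendRCLike_apply G x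
  have hφJ : ∀ x, φ (J x) = conj (φ x) := fun x => by
    apply RCLike.ext
    · rw [hre, RCLike.conj_re, hre, hGJ]
    · have h1 : J ((RCLike.I : 𝕜) • x) = -((RCLike.I : 𝕜) • J x) := by
        rw [map_smulₛₗ, RCLike.conj_I, neg_smul]
      rw [him, RCLike.conj_im, him, ← hGJ ((RCLike.I : 𝕜) • x), h1, map_neg, neg_neg]
  refine ⟨φ, hφJ, ?_, fun p hp hpJ => ?_⟩
  · have h1 := hφJ e
    rw [he] at h1
    rw [← RCLike.conj_eq_iff_re.1 h1.symm, hre]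
    have h2 := hge 1 0
    rw [hsplit, one_smul] at h2
    congr 1; linarith
  · have h1 := hgs p (by rw [hs, hR _ hpJ]; exact hp)
    rw [show p = (p.1, p.2) from rfl, hsplit] at h1
    rw [hre]; linarith

/-- A hermitian functional that is bounded below on a ball of hermitian elements is bounded. -/
theorem exists_bound_of_hermitian {U : Type*} [NormedAddCommGroup U] [NormedSpace 𝕜 U]
    (J : U →L⋆[𝕜] U) (hJ : ∀ x, J (J x) = x) (φ : U →ₗ[𝕜] 𝕜) (hφ : ∀ x, φ (J x) = conj (φ x))
    (ρ K : ℝ) (hρ : 0 < ρ) (hK : ∀ x, J x = x → ‖x‖ < ρ → -K ≤ RCLike.re (φ x)) :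
    ∃ M, ∀ x, ‖φ x‖ ≤ M * ‖x‖ := by
  have hK0 : 0 ≤ K := by
    have := hK 0 (map_zero J) (by simpa using hρ)
    simpa using this
  have key : ∀ y, J y = y → RCLike.re (φ y) ≤ K * (2 / ρ) * ‖y‖ := fun y hy => by
    rcases eq_or_ne y 0 with rfl | hy0
    · simp
    have hn : 0 < ‖y‖ := norm_pos_iff.2 hy0
    -- The negative sign turns the lower bound on the ball into an upper bound; the scaled vector
    -- has norm `ρ / 2`.
    set c : ℝ := -(ρ / (2 * ‖y‖)) with hc
    have h1 := hK ((c : 𝕜) • y) (by rw [map_smulₛₗ, RCLike.conj_ofReal, hy]) (by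
      rw [norm_smul, RCLike.norm_ofReal, hc, abs_neg, abs_of_pos (by positivity)]
      field_simp; linarith)
    rw [map_smul, smul_eq_mul, RCLike.re_ofReal_mul] at h1
    have h2 : RCLike.re (φ y) * (ρ / (2 * ‖y‖)) ≤ K := by rw [hc] at h1; linarith
    rw [← le_div_iff₀ (by positivity)] at h2
    refine h2.trans_eq ?_
    field_simp
  -- `J` need not be isometric, so passing to the hermitian part of the phase-rotated `x` costs the
  -- factor `(1 + ‖J‖) / 2`.
  refine ⟨K * (2 / ρ) * ((1 + ‖J‖) / 2), fun x => ?_⟩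
  obtain ⟨c, hc, hcx⟩ := RCLike.exists_norm_eq_mul_self (φ x)
  set y : U := ((1 / 2 : ℝ) : 𝕜) • (c • x + J (c • x)) with hy
  have hJy : J y = y := by rw [hy, map_smulₛₗ, RCLike.conj_ofReal, map_add, hJ, add_comm]
  have h1 : RCLike.re (φ y) = ‖φ x‖ := by
    have h0 : φ (c • x) = (‖φ x‖ : 𝕜) := by rw [φ.map_smul, smul_eq_mul, hcx]
    rw [hy, φ.map_smul, φ.map_add, hφ, h0, smul_eq_mul,
      RCLike.re_ofReal_mul, RCLike.conj_ofReal, map_add, RCLike.ofReal_re]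
    ring
  have h2 : ‖y‖ ≤ (1 + ‖J‖) / 2 * ‖x‖ := by
    rw [hy, norm_smul, RCLike.norm_ofReal, abs_of_pos (by norm_num : (0 : ℝ) < 1 / 2)]
    have h3 : ‖c • x‖ = ‖x‖ := by rw [norm_smul, hc, one_mul]
    have h4 := (norm_add_le (c • x) (J (c • x))).trans
      (add_le_add_right (J.le_opNorm (c • x)) _)
    rw [h3] at h4
    linarith
  rw [← h1]
  refine (key y hJy).trans ?_
  rw [mul_assoc (K * (2 / ρ))]
  exact mul_le_mul_of_nonneg_left h2 (by positivity)

/-- A hermitian form dominated on the diagonal by a positive semidefinite one satisfies the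
corresponding Cauchy–Schwarz inequality. -/
theorem norm_sq_le_of_abs_diag_le {H : Type*} [AddCommGroup H] [Module 𝕜 H]
    (B : H → H → 𝕜) (S : H → ℝ) (k : ℝ)
    (hadd : ∀ x y z, B x (y + z) = B x y + B x z) (hsmul : ∀ x (c : 𝕜) y, B x (c • y) = c * B x y)
    (hherm : ∀ x y, B x y = conj (B y x))
    (hpar : ∀ x y, S (x + y) + S (x - y) = 2 * (S x + S y))
    (hSsmul : ∀ (c : 𝕜) x, S (c • x) = ‖c‖ ^ 2 * S x)
    (hdiag : ∀ x, |RCLike.re (B x x)| ≤ k * S x) (x y : H) :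
    ‖B x y‖ ^ 2 ≤ k ^ 2 * (S x * S y) := by
  obtain ⟨c, hc, hcx⟩ := RCLike.exists_norm_eq_mul_self (B x y)
  have hadd' : ∀ x y z, B (x + y) z = B x z + B y z := fun x y z => by
    rw [hherm, hadd, map_add, ← hherm, ← hherm]
  have hneg : ∀ x y, B x (-y) = - B x y := fun x y => by
    rw [← neg_one_smul 𝕜 y, hsmul, neg_one_mul]
  have hneg' : ∀ x y, B (-x) y = - B x y := fun x y => by
    rw [hherm, hneg, map_neg, ← hherm]
  have hpol : ∀ x y, 4 * RCLike.re (B x y)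
      = RCLike.re (B (x + y) (x + y)) - RCLike.re (B (x - y) (x - y)) := fun x y => by
    simp only [sub_eq_add_neg, hadd, hadd', hneg, hneg', map_add, map_neg]
    rw [hherm y x, RCLike.conj_re]; ring
  -- Polarization at `s x` and the rotated vector `c y`, followed by the parallelogram law for `S`.
  -- The discriminant of this quadratic is the claim, also when `k * S x = 0`.
  have hmain : ∀ s : ℝ, 0 ≤ (k * S x) * (s * s) + (-(2 * ‖B x y‖)) * s + k * S y := fun s => by
    have h1 := hpol ((s : 𝕜) • x) (c • y)
    have h2 : RCLike.re (B ((s : 𝕜) • x) (c • y)) = s * ‖B x y‖ := by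
      have h0 : B ((s : 𝕜) • x) (c • y) = s * (‖B x y‖ : 𝕜) := by
        rw [hsmul, hherm, hsmul, (starRingEnd 𝕜).map_mul, ← hherm, RCLike.conj_ofReal,
          mul_left_comm, ← hcx]
      rw [h0, RCLike.re_ofReal_mul, RCLike.ofReal_re]
    have h3 := (abs_le.1 (hdiag ((s : 𝕜) • x + c • y))).2
    have h4 := (abs_le.1 (hdiag ((s : 𝕜) • x - c • y))).1
    have h5 := hpar ((s : 𝕜) • x) (c • y)
    rw [hSsmul, hSsmul, hc, RCLike.norm_ofReal, sq_abs] at h5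
    have h6 := congrArg (k * ·) h5
    beta_reduce at h6
    nlinarith
  have := discrim_le_zero hmain
  rw [discrim] at this
  nlinarith

end General

/-! ### Factorization of positive operators -/

section Factor

variable {𝕜 : Type*} [RCLike 𝕜]

/-- A positive semidefinite sesquilinear form is the pullback of a Hilbert space inner product. -/
theorem exists_hilbert_of_core {M : Type u} [AddCommGroup M] [Module 𝕜 M]
    (c : PreInnerProductSpace.Core 𝕜 M) :
    ∃ (K : Type u) (_ : NormedAddCommGroup K) (_ : InnerProductSpace 𝕜 K) (_ : CompleteSpace K)
      (j : M →ₗ[𝕜] K), ∀ x y, (inner 𝕜 (j x) (j y) : 𝕜) = c.inner x y := by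
  let _ : SeminormedAddCommGroup M :=
    @InnerProductSpace.Core.toSeminormedAddCommGroup 𝕜 M _ _ _ c
  let _ : InnerProductSpace 𝕜 M := InnerProductSpace.ofCore c
  -- The completion is Hausdorff, so null vectors of the form are collapsed at the same time.
  exact ⟨UniformSpace.Completion M, inferInstance, inferInstance, inferInstance,
    (UniformSpace.Completion.toComplL (𝕜 := 𝕜) (E := M)).toLinearMap,
    fun x y => UniformSpace.Completion.inner_coe x y⟩

/-- Every positive operator is of the form `S* S` for an operator `S` into a Hilbert space. -/
theorem exists_adjoint_comp_self_eq {N : Type u} [NormedAddCommGroup N] [InnerProductSpace 𝕜 N]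
    [CompleteSpace N] (P : N →L[𝕜] N) (hP : P.IsPositive) :
    ∃ (K : Type u) (_ : NormedAddCommGroup K) (_ : InnerProductSpace 𝕜 K) (_ : CompleteSpace K)
      (S : N →L[𝕜] K), S.adjoint ∘L S = P := by
  obtain ⟨K, _, _, _, j, hj⟩ := exists_hilbert_of_core (𝕜 := 𝕜) (M := N)
    { inner := fun x y => inner 𝕜 (P x) y
      conj_inner_symm := fun x y => by
        rw [inner_conj_symm, hP.inner_left_eq_inner_right]
      re_inner_nonneg := fun x => hP.re_inner_nonneg_left x
      add_left := fun x y z => by simp only [map_add, inner_add_left]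
      smul_left := fun x y r => by simp only [map_smul, inner_smul_left] }
  -- Here `‖j x‖² = ⟨P x, x⟩ ≤ ‖P‖ ‖x‖²`.
  have hb : ∀ x : N, ‖j x‖ ≤ Real.sqrt ‖P‖ * ‖x‖ := fun x => by
    rw [← Real.sqrt_sq (norm_nonneg x), ← Real.sqrt_mul (norm_nonneg P)]
    apply Real.le_sqrt_of_sq_le
    rw [← inner_self_eq_norm_sq (𝕜 := 𝕜), hj]
    refine (RCLike.re_le_norm _).trans ((norm_inner_le_norm _ _).trans ?_)
    rw [sq, ← mul_assoc]
    exact mul_le_mul_of_nonneg_right (P.le_opNorm x) (norm_nonneg x)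
  refine ⟨K, inferInstance, inferInstance, inferInstance, j.mkContinuous _ hb, ?_⟩
  ext x
  refine ext_inner_right 𝕜 fun y => ?_
  rw [ContinuousLinearMap.comp_apply, ContinuousLinearMap.adjoint_inner_left]
  exact hj x y

end Factor

/-! ### Maps on projective tensor products -/

section Tensor

variable {𝕜 : Type*} [RCLike 𝕜] {A B G : Type*}
  [NormedAddCommGroup A] [NormedSpace 𝕜 A] [NormedAddCommGroup B] [NormedSpace 𝕜 B]
  [NormedAddCommGroup G] [NormedSpace 𝕜 G]

/-- Two continuous additive maps that agree on elementary tensors are equal. -/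
theorem projTensor_addHom_ext (f g : ProjTensor 𝕜 A B →+ G) (hf : Continuous f)
    (hg : Continuous g) (h : ∀ a b, f (tmulL 𝕜 A B a b) = g (tmulL 𝕜 A B a b))
    (X : ProjTensor 𝕜 A B) : f X = g X := by
  refine UniformSpace.Completion.induction_on X (isClosed_eq hf hg) fun u => ?_
  induction u using TensorProduct.induction_on with
  | zero => rw [UniformSpace.Completion.coe_zero, map_zero, map_zero]
  | tmul a b => exact h a b
  | add x y hx hy => rw [UniformSpace.Completion.coe_add, map_add, map_add, hx, hy]

theorem projTensor_ext {f g : ProjTensor 𝕜 A B →L[𝕜] G}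
    (h : ∀ a b, f (tmulL 𝕜 A B a b) = g (tmulL 𝕜 A B a b)) : f = g :=
  ContinuousLinearMap.ext fun X => projTensor_addHom_ext (f : ProjTensor 𝕜 A B →+ G)
    (g : ProjTensor 𝕜 A B →+ G) f.continuous g.continuous h X

theorem norm_tmulL_le : ‖tmulL 𝕜 A B‖ ≤ 1 :=
  LinearMap.mkContinuous₂_norm_le _ zero_le_one _

theorem norm_lift_le [CompleteSpace G] (f : A →L[𝕜] B →L[𝕜] G) : ‖lift f‖ ≤ ‖f‖ := by
  refine ContinuousLinearMap.opNorm_le_bound _ (norm_nonneg f) fun X => ?_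
  refine UniformSpace.Completion.induction_on X
    (isClosed_le (lift f).continuous.norm (continuous_const.mul continuous_norm)) fun u => ?_
  rw [lift_coe, UniformSpace.Completion.norm_coe]
  exact (ContinuousLinearMap.le_opNorm _ _).trans
    (mul_le_mul_of_nonneg_right (LinearMap.mkContinuous_norm_le _ (norm_nonneg f) _)
      (norm_nonneg u))

/-- The bound does not involve `B`; this is why every bounded map is completely bounded for the
projective norm. -/
theorem norm_mapLeft_le {A' : Type*} [NormedAddCommGroup A'] [NormedSpace 𝕜 A']
    (Λ : A →L[𝕜] A') : ‖mapLeft B Λ‖ ≤ ‖Λ‖ :=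
  (norm_lift_le _).trans <| (ContinuousLinearMap.opNorm_comp_le _ _).trans <|
    mul_le_of_le_one_left (norm_nonneg Λ) norm_tmulL_le

theorem exists_norm_mapLeft_le {A' : Type*} [NormedAddCommGroup A'] [NormedSpace 𝕜 A']
    (Λ : A →L[𝕜] A') : ∃ C : ℝ, ∀ (B : Type u) [NormedAddCommGroup B] [NormedSpace 𝕜 B],
      ‖mapLeft B Λ‖ ≤ C :=
  ⟨‖Λ‖, fun _ _ _ => norm_mapLeft_le Λ⟩

theorem norm_tmulL_apply_le (a : A) : ‖tmulL 𝕜 A B a‖ ≤ ‖a‖ :=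
  (ContinuousLinearMap.le_opNorm _ _).trans
    (mul_le_of_le_one_left (norm_nonneg a) norm_tmulL_le)

theorem norm_const_add_linear_le (w : G) (f : B →L[𝕜] G) (g : A →L[𝕜] G) :
    ‖ContinuousAffineMap.const 𝕜 (A × B) w
      + (f.comp (ContinuousLinearMap.snd 𝕜 A B)
        - g.comp (ContinuousLinearMap.fst 𝕜 A B)).toContinuousAffineMap‖
      ≤ max ‖w‖ (‖f‖ + ‖g‖) := by
  rw [ContinuousAffineMap.norm_def]
  refine max_le_max ?_ ?_
  · have h0 : (ContinuousAffineMap.const 𝕜 (A × B) w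
      + (f.comp (ContinuousLinearMap.snd 𝕜 A B)
        - g.comp (ContinuousLinearMap.fst 𝕜 A B)).toContinuousAffineMap) 0 = w := by simp
    rw [h0]
  · have h1 : (ContinuousAffineMap.const 𝕜 (A × B) w
      + (f.comp (ContinuousLinearMap.snd 𝕜 A B)
        - g.comp (ContinuousLinearMap.fst 𝕜 A B)).toContinuousAffineMap).contLinear
        = f.comp (ContinuousLinearMap.snd 𝕜 A B) - g.comp (ContinuousLinearMap.fst 𝕜 A B) := by
      rw [ContinuousAffineMap.add_contLinear, ContinuousAffineMap.const_contLinear, zero_add]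
      rfl
    rw [h1]
    refine (norm_sub_le _ _).trans (add_le_add ?_ ?_)
    · exact (ContinuousLinearMap.opNorm_comp_le _ _).trans
        (mul_le_of_le_one_right (norm_nonneg _) (ContinuousLinearMap.norm_snd_le ..))
    · exact (ContinuousLinearMap.opNorm_comp_le _ _).trans
        (mul_le_of_le_one_right (norm_nonneg _) (ContinuousLinearMap.norm_fst_le ..))

theorem mapRight_mapRight {B' B'' : Type*} [NormedAddCommGroup B'] [NormedSpace 𝕜 B']
    [NormedAddCommGroup B''] [NormedSpace 𝕜 B''] (φ : B →L[𝕜] B') (ψ : B' →L[𝕜] B'')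
    (X : ProjTensor 𝕜 A B) : mapRight A ψ (mapRight A φ X) = mapRight A (ψ.comp φ) X := by
  have : (mapRight A ψ).comp (mapRight A φ) = mapRight A (ψ.comp φ) :=
    projTensor_ext fun a b => by simp [mapRight_tmul]
  rw [← this]; rfl

theorem mapRight_id (X : ProjTensor 𝕜 A B) :
    mapRight A (ContinuousLinearMap.id 𝕜 B) X = X := by
  have : mapRight A (ContinuousLinearMap.id 𝕜 B) = ContinuousLinearMap.id 𝕜 _ :=
    projTensor_ext fun a b => by simp [mapRight_tmul]
  rw [this]; rfl

theorem mapRight_smul {B' : Type*} [NormedAddCommGroup B'] [NormedSpace 𝕜 B']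
    (c : 𝕜) (φ : B →L[𝕜] B') (X : ProjTensor 𝕜 A B) :
    mapRight A (c • φ) X = c • mapRight A φ X := by
  have : mapRight A (c • φ) = c • mapRight A φ :=
    projTensor_ext fun a b => by simp [mapRight_tmul]
  rw [this]; rfl

variable [StarAddMonoid A] [StarModule 𝕜 A] [ContinuousStar A]
  [StarAddMonoid B] [StarModule 𝕜 B] [ContinuousStar B]

theorem adj_adj (X : ProjTensor 𝕜 A B) : adj (adj X) = X :=
  projTensor_addHom_ext ((adj : ProjTensor 𝕜 A B →L⋆[𝕜] _).toLinearMap.toAddMonoidHom.comp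
      (adj : ProjTensor 𝕜 A B →L⋆[𝕜] _).toLinearMap.toAddMonoidHom) (AddMonoidHom.id _)
    (adj.continuous.comp adj.continuous) continuous_id
    (fun a b => by
      change adj (adj (tmulL 𝕜 A B a b)) = tmulL 𝕜 A B a b
      rw [adj_tmul, adj_tmul, star_star, star_star]) X

/-- Two maps are needed because the adjoint exchanges `Z ↦ W* Z V` and `Z ↦ V* Z W`. -/
theorem mapRight_adj {B' : Type*} [NormedAddCommGroup B'] [NormedSpace 𝕜 B']
    [StarAddMonoid B'] [StarModule 𝕜 B'] [ContinuousStar B'] (φ ψ : B →L[𝕜] B')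
    (h : ∀ Z, φ (star Z) = star (ψ Z)) (X : ProjTensor 𝕜 A B) :
    mapRight A φ (adj X) = adj (mapRight A ψ X) :=
  projTensor_addHom_ext ((mapRight A φ).toLinearMap.toAddMonoidHom.comp
      (adj : ProjTensor 𝕜 A B →L⋆[𝕜] _).toLinearMap.toAddMonoidHom)
    ((adj : ProjTensor 𝕜 A B' →L⋆[𝕜] _).toLinearMap.toAddMonoidHom.comp
      (mapRight A ψ).toLinearMap.toAddMonoidHom)
    ((mapRight A φ).continuous.comp adj.continuous)
    (adj.continuous.comp (mapRight A ψ).continuous)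
    (fun a b => by
      change mapRight A φ (adj (tmulL 𝕜 A B a b)) = adj (mapRight A ψ (tmulL 𝕜 A B a b))
      rw [adj_tmul, mapRight_tmul, mapRight_tmul, adj_tmul, h]) X

end Tensor

/-! ### Compressions, columns and direct sums -/

section Compressions

variable {𝕜 : Type*} [RCLike 𝕜]
  {N : Type*} [NormedAddCommGroup N] [InnerProductSpace 𝕜 N] [CompleteSpace N]
  {E : Type*} [NormedAddCommGroup E] [InnerProductSpace 𝕜 E] [CompleteSpace E]
  {K : Type*} [NormedAddCommGroup K] [InnerProductSpace 𝕜 K] [CompleteSpace K]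
  {A : Type*} [NormedAddCommGroup A] [NormedSpace 𝕜 A]

theorem sandwich_comp_sandwich (W V : K →L[𝕜] E) (W' V' : N →L[𝕜] K) :
    (sandwich W' V').comp (sandwich W V) = sandwich (W ∘L W') (V ∘L V') := by
  ext Z
  simp [sandwich_apply, ContinuousLinearMap.adjoint_comp]

theorem sandwich_sandwich (W V : K →L[𝕜] E) (W' V' : N →L[𝕜] K) (Z : E →L[𝕜] E) :
    sandwich W' V' (sandwich W V Z) = sandwich (W ∘L W') (V ∘L V') Z := by
  rw [← sandwich_comp_sandwich]; rfl

theorem inner_sandwich (W V : N →L[𝕜] K) (Z : K →L[𝕜] K) (x y : N) :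
    (inner 𝕜 x (sandwich W V Z y) : 𝕜) = inner 𝕜 (W x) (Z (V y)) := by
  simp [sandwich_apply, ContinuousLinearMap.adjoint_inner_right]

theorem sandwich_star (W V : N →L[𝕜] K) (Z : K →L[𝕜] K) :
    sandwich W V (star Z) = star (sandwich V W Z) := by
  simp [sandwich_apply, ContinuousLinearMap.star_eq_adjoint, ContinuousLinearMap.adjoint_comp,
    ContinuousLinearMap.comp_assoc]

theorem sandwich_mono (V : N →L[𝕜] K) {S T : K →L[𝕜] K} (h : S ≤ T) :
    sandwich V V S ≤ sandwich V V T := by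
  rw [ContinuousLinearMap.le_def] at h ⊢
  rw [← map_sub, sandwich_apply]
  exact h.adjoint_conj V

theorem compress_compress (V : N →L[𝕜] K) (W : K →L[𝕜] E) (X : ProjTensor 𝕜 A (E →L[𝕜] E)) :
    compress V (compress W X) = compress (W ∘L V) X := by
  rw [compress, compress, mapRight_mapRight, sandwich_comp_sandwich, compress]

theorem compress_one (X : ProjTensor 𝕜 A (N →L[𝕜] N)) :
    compress (1 : N →L[𝕜] N) X = X := by
  have : sandwich (1 : N →L[𝕜] N) 1 = ContinuousLinearMap.id 𝕜 _ := by
    ext Z x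
    refine ext_inner_left 𝕜 fun y => ?_
    rw [inner_sandwich]; rfl
  rw [compress, this, mapRight_id]

theorem compress_smul (c : ℝ) (V : N →L[𝕜] K) (X : ProjTensor 𝕜 A (K →L[𝕜] K)) :
    compress ((c : 𝕜) • V) X = ((c ^ 2 : ℝ) : 𝕜) • compress V X := by
  have : sandwich ((c : 𝕜) • V) ((c : 𝕜) • V) = ((c ^ 2 : ℝ) : 𝕜) • sandwich V V := by
    ext Z x
    refine ext_inner_left 𝕜 fun y => ?_
    rw [inner_sandwich]
    simp only [smul_apply, inner_sandwich, inner_smul_left, inner_smul_right,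
      map_smul, RCLike.conj_ofReal]
    push_cast; ring
  rw [compress, this, mapRight_smul, compress]

theorem adj_compress [StarAddMonoid A] [StarModule 𝕜 A] [ContinuousStar A] (V : N →L[𝕜] K)
    (X : ProjTensor 𝕜 A (K →L[𝕜] K)) : adj (compress V X) = compress V (adj X) :=
  (mapRight_adj _ _ (sandwich_star V V) X).symm

/-- The operator `x ↦ (V x, W x)` into a Hilbert sum. -/
def column (V : N →L[𝕜] E) (W : N →L[𝕜] K) : N →L[𝕜] WithLp 2 (E × K) :=
  (WithLp.prodContinuousLinearEquiv 2 𝕜 E K).symm.toContinuousLinearMap ∘L V.prod W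

theorem fstL_comp_column (V : N →L[𝕜] E) (W : N →L[𝕜] K) :
    WithLp.fstL 2 𝕜 E K ∘L column V W = V := rfl

theorem sndL_comp_column (V : N →L[𝕜] E) (W : N →L[𝕜] K) :
    WithLp.sndL 2 𝕜 E K ∘L column V W = W := rfl

theorem sandwich_column_opSum (V : N →L[𝕜] E) (W : N →L[𝕜] K) (S : E →L[𝕜] E)
    (T : K →L[𝕜] K) :
    sandwich (column V W) (column V W) (opSum S T) = sandwich V V S + sandwich W W T := by
  rw [opSum, map_add, sandwich_sandwich, sandwich_sandwich, fstL_comp_column, sndL_comp_column]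

theorem compress_column_tensorSum (V : N →L[𝕜] E) (W : N →L[𝕜] K)
    (X : ProjTensor 𝕜 A (E →L[𝕜] E)) (Y : ProjTensor 𝕜 A (K →L[𝕜] K)) :
    compress (column V W) (tensorSum X Y) = compress V X + compress W Y := by
  rw [tensorSum, map_add, compress_compress, compress_compress, fstL_comp_column,
    sndL_comp_column]

theorem adjoint_column_comp_column (V : N →L[𝕜] E) (W : N →L[𝕜] K) :
    (column V W).adjoint ∘L column V W = V.adjoint ∘L V + W.adjoint ∘L W := by
  ext x
  refine ext_inner_left 𝕜 fun y => ?_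
  simp only [ContinuousLinearMap.comp_apply, add_apply, inner_add_right,
    ContinuousLinearMap.adjoint_inner_right]
  exact WithLp.prod_inner_apply _ _

theorem opSum_mono {S S' : E →L[𝕜] E} {T T' : K →L[𝕜] K} (hS : S ≤ S') (hT : T ≤ T') :
    opSum S T ≤ opSum S' T' := by
  have h1 := sandwich_mono (WithLp.fstL 2 𝕜 E K) hS
  have h2 := sandwich_mono (WithLp.sndL 2 𝕜 E K) hT
  rw [ContinuousLinearMap.le_def] at h1 h2 ⊢
  rw [opSum, opSum, add_sub_add_comm]
  exact h1.add h2

/-- A positive invertible operator is bounded below. -/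
theorem exists_norm_sq_le_re_inner (P : E →L[𝕜] E) (hP : IsStrictlyPositive P) :
    ∃ k : ℝ, 0 ≤ k ∧ ∀ x, ‖x‖ ^ 2 ≤ k * RCLike.re (inner 𝕜 x (P x)) := by
  have hpos : P.IsPositive := (ContinuousLinearMap.nonneg_iff_isPositive P).1 hP.1
  obtain ⟨⟨P', Q, h1, h2⟩, rfl⟩ := hP.2
  change P'.IsPositive at hpos
  change ∃ k : ℝ, 0 ≤ k ∧ ∀ x, ‖x‖ ^ 2 ≤ k * RCLike.re (inner 𝕜 x (P' x))
  have hq : ∀ x, 0 ≤ RCLike.re (inner 𝕜 x (P' x) : 𝕜) := hpos.re_inner_nonneg_right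
  -- Cauchy–Schwarz for the form `⟨x, P' y⟩`. Taking `P' x` and `x` as arguments then gives `‖P' x‖²
  -- ≤ ‖P'‖ ⟨x, P' x⟩`, without a square root of `P'`.
  have hcs : ∀ x y, ‖(inner 𝕜 x (P' y) : 𝕜)‖ ^ 2
      ≤ 1 ^ 2 * (RCLike.re (inner 𝕜 x (P' x) : 𝕜) * RCLike.re (inner 𝕜 y (P' y) : 𝕜)) := by
    refine norm_sq_le_of_abs_diag_le (𝕜 := 𝕜) (fun x y => inner 𝕜 x (P' y))
      (fun x => RCLike.re (inner 𝕜 x (P' x) : 𝕜)) 1 (fun x y z => ?_) (fun x c y => ?_)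
      (fun x y => ?_) (fun x y => ?_) (fun c x => ?_) (fun x => ?_)
    · simp only [map_add, inner_add_right]
    · simp only [map_smul, inner_smul_right]
    · rw [inner_conj_symm, hpos.inner_left_eq_inner_right]
    · simp only [map_add, map_sub, inner_add_right, inner_add_left, inner_sub_left,
        inner_sub_right]
      ring
    · simp only [map_smul, inner_smul_left, inner_smul_right]
      rw [← mul_assoc, RCLike.mul_conj, ← RCLike.ofReal_pow, RCLike.re_ofReal_mul]
    · rw [abs_of_nonneg (hq x), one_mul]
  have hbd : ∀ x, ‖P' x‖ ^ 2 ≤ ‖P'‖ * RCLike.re (inner 𝕜 x (P' x) : 𝕜) := fun x => by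
    rcases eq_or_ne (P' x) 0 with h0 | h0
    · rw [h0, norm_zero, inner_zero_right, map_zero]; simp
    have hn : 0 < ‖P' x‖ ^ 2 := pow_pos (norm_pos_iff.2 h0) 2
    have h3 := hcs (P' x) x
    rw [inner_self_eq_norm_sq_to_K, ← RCLike.ofReal_pow, RCLike.norm_ofReal,
      abs_of_pos hn, one_pow, one_mul] at h3
    have h4 : RCLike.re (inner 𝕜 (P' x) (P' (P' x)) : 𝕜) ≤ ‖P'‖ * ‖P' x‖ ^ 2 := by
      refine (RCLike.re_le_norm _).trans ((norm_inner_le_norm _ _).trans ?_)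
      have := mul_le_mul_of_nonneg_left (P'.le_opNorm (P' x)) (norm_nonneg (P' x))
      linarith
    have h5 := h3.trans (mul_le_mul_of_nonneg_right h4 (hq x))
    refine le_of_mul_le_mul_right ?_ hn
    linarith
  refine ⟨‖Q‖ ^ 2 * ‖P'‖, by positivity, fun x => ?_⟩
  have h6 : ‖x‖ ≤ ‖Q‖ * ‖P' x‖ := by
    have : Q (P' x) = x := by
      exact congrArg (fun R : E →L[𝕜] E => R x) h2
    calc ‖x‖ = ‖Q (P' x)‖ := by rw [this]
      _ ≤ _ := Q.le_opNorm _
  calc ‖x‖ ^ 2 ≤ (‖Q‖ * ‖P' x‖) ^ 2 := pow_le_pow_left₀ (norm_nonneg x) h6 2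
    _ = ‖Q‖ ^ 2 * ‖P' x‖ ^ 2 := by ring
    _ ≤ ‖Q‖ ^ 2 * (‖P'‖ * RCLike.re (inner 𝕜 x (P' x) : 𝕜)) :=
      mul_le_mul_of_nonneg_left (hbd x) (by positivity)
    _ = _ := by ring

end Compressions

/-! ### From functionals on `A ⊗ B(N)` to pencils -/

section Functionals

variable {𝕜 : Type*} [RCLike 𝕜]
  {N : Type u} [NormedAddCommGroup N] [InnerProductSpace 𝕜 N] [CompleteSpace N]
  {A : Type w} [NormedAddCommGroup A] [NormedSpace 𝕜 A]
  {E : Type u} [NormedAddCommGroup E] [InnerProductSpace 𝕜 E] [CompleteSpace E]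

/-- The map `A → B(N)*` corresponding to a functional on `A ⊗ B(N)`. -/
def dualMap (ℓ : StrongDual 𝕜 (ProjTensor 𝕜 A (N →L[𝕜] N))) : A →L[𝕜] OpDual 𝕜 N :=
  (ContinuousLinearMap.compL 𝕜 (N →L[𝕜] N) (ProjTensor 𝕜 A (N →L[𝕜] N)) 𝕜 ℓ).comp
    (tmulL 𝕜 A (N →L[𝕜] N))

theorem dualMap_apply (ℓ : StrongDual 𝕜 (ProjTensor 𝕜 A (N →L[𝕜] N))) (a : A)
    (Z : N →L[𝕜] N) : dualMap ℓ a Z = ℓ (tmulL 𝕜 A (N →L[𝕜] N) a Z) := rfl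

/-- Both sides send `a ⊗ Z` to `ℓ(a ⊗ W* Z V)`. This reduces every statement about `Λ(X)` at level
`E` to `ℓ` at level `N`. -/
theorem form_amplify_dualMap (ℓ : StrongDual 𝕜 (ProjTensor 𝕜 A (N →L[𝕜] N)))
    (W V : N →L[𝕜] E) (X : ProjTensor 𝕜 A (E →L[𝕜] E)) :
    form W V (amplify (dualMap ℓ) E X) = ℓ (mapRight A (sandwich W V) X) := by
  have : (form W V).comp (amplify (dualMap ℓ) E) = ℓ.comp (mapRight A (sandwich W V)) := by
    refine projTensor_ext fun a Z => ?_
    rw [ContinuousLinearMap.comp_apply, ContinuousLinearMap.comp_apply, amplify, mapLeft_tmul,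
      form_tmul, mapRight_tmul, dualMap_apply, sandwich_apply]
  exact congrArg (fun f => f X) this

theorem form_pencil_dualMap (T : OpDual 𝕜 N) (v : N)
    (ℓ : StrongDual 𝕜 (ProjTensor 𝕜 A (N →L[𝕜] N))) (W V : N →L[𝕜] E) (Y : E →L[𝕜] E)
    (X : ProjTensor 𝕜 A (E →L[𝕜] E)) :
    form W V (pencil T v (dualMap ℓ) E (Y, X))
      = T (W.adjoint ∘L V) - inner 𝕜 (W v) (Y (V v)) + ℓ (mapRight A (sandwich W V) X) := by
  rw [pencil_apply, map_add, map_sub, form_amplify_dualMap, form_tmul, form_tmul,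
    vecFunctional_apply, ← sandwich_apply W V Y, inner_sandwich]
  rfl

theorem isCompletelyBounded (Λ : A →L[𝕜] OpDual 𝕜 N) : IsCompletelyBounded Λ := by
  obtain ⟨C, hC⟩ := exists_norm_mapLeft_le.{u} (𝕜 := 𝕜) (A := A) (A' := OpDual 𝕜 N) Λ
  exact ⟨C, fun E _ _ _ => hC (E →L[𝕜] E)⟩

theorem isCompletelyBoundedAffine_pencil (T : OpDual 𝕜 N) (v : N) (Λ : A →L[𝕜] OpDual 𝕜 N) :
    IsCompletelyBoundedAffine
      (fun (E : Type u) [NormedAddCommGroup E] [InnerProductSpace 𝕜 E] [CompleteSpace E] =>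
        pencil T v Λ E) := by
  obtain ⟨C, hC⟩ := exists_norm_mapLeft_le.{u} (𝕜 := 𝕜) (A := A) (A' := OpDual 𝕜 N) Λ
  refine ⟨max ‖T‖ (C + ‖vecFunctional (𝕜 := 𝕜) v‖), fun E _ _ _ => ?_⟩
  refine (norm_const_add_linear_le _ _ _).trans (max_le_max ?_ (add_le_add (hC _) ?_))
  · refine (ContinuousLinearMap.le_opNorm _ _).trans ?_
    refine (mul_le_of_le_one_right (norm_nonneg _) ?_).trans (norm_tmulL_apply_le T)
    exact ContinuousLinearMap.norm_id_le
  · exact norm_tmulL_apply_le _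

end Functionals

/-! ### The cone of compressed hypographs -/

section Cone

variable {𝕜 : Type*} [RCLike 𝕜]
  {A : Type w} [NormedAddCommGroup A] [NormedSpace 𝕜 A]

/-- The cone of all `((Z, V* X V), s)` with `V : N → E` bounded, `V* V ≤ Z`, and
`s ≤ ⟨V v, Y V v⟩` for some `Y ≤ F(X)`. -/
def hypoCone (D : SetFamily.{u} 𝕜 A) (F : FunFamily.{u} 𝕜 A)
    {N : Type u} [NormedAddCommGroup N] [InnerProductSpace 𝕜 N] [CompleteSpace N] (v : N) :
    Set (((N →L[𝕜] N) × ProjTensor 𝕜 A (N →L[𝕜] N)) × ℝ) :=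
  {q | ∃ (E : Type u) (_ : NormedAddCommGroup E) (_ : InnerProductSpace 𝕜 E)
    (_ : CompleteSpace E) (V : N →L[𝕜] E), ∃ p ∈ hypo D F E,
      V.adjoint ∘L V ≤ q.1.1 ∧ compress V p.2 = q.1.2 ∧
        q.2 ≤ RCLike.re (inner 𝕜 (V v) (p.1 (V v)) : 𝕜)}

variable {D : SetFamily.{u} 𝕜 A} {F : FunFamily.{u} 𝕜 A}
  {N : Type u} [NormedAddCommGroup N] [InnerProductSpace 𝕜 N] [CompleteSpace N]

/-- Compressing a direct sum by a column adds the compressions, so direct sums across levels become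
sums at level `N`. -/
theorem add_mem_hypoCone (hDsum : ClosedUnderSums D) (hFsum : PreservesSums D F) (v : N)
    (p q : ((N →L[𝕜] N) × ProjTensor 𝕜 A (N →L[𝕜] N)) × ℝ) (hp : p ∈ hypoCone D F v)
    (hq : q ∈ hypoCone D F v) : p + q ∈ hypoCone D F v := by
  obtain ⟨E, _, _, _, V, ⟨Y, X⟩, ⟨hX, hY⟩, hV, hc, hs⟩ := hp
  obtain ⟨E', _, _, _, V', ⟨Y', X'⟩, ⟨hX', hY'⟩, hV', hc', hs'⟩ := hq
  refine ⟨WithLp 2 (E × E'), inferInstance, inferInstance, inferInstance, column V V',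
    (opSum Y Y', tensorSum X X'), ⟨hDsum E E' X hX X' hX', ?_⟩, ?_, ?_, ?_⟩
  · change opSum Y Y' ≤ F _ (tensorSum X X')
    rw [hFsum E E' X hX X' hX']
    exact opSum_mono hY hY'
  · rw [adjoint_column_comp_column]
    rw [ContinuousLinearMap.le_def] at hV hV' ⊢
    rw [Prod.fst_add, Prod.fst_add, add_sub_add_comm]
    exact hV.add hV'
  · change compress (column V V') (tensorSum X X') = _
    rw [compress_column_tensorSum]
    exact congrArg₂ (· + ·) hc hc'
  · change p.2 + q.2 ≤ RCLike.re (inner 𝕜 (column V V' v) (opSum Y Y' (column V V' v)) : 𝕜)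
    rw [← inner_sandwich, sandwich_column_opSum, add_apply, inner_add_right,
      inner_sandwich, inner_sandwich, map_add]
    exact add_le_add hs hs'

theorem smul_mem_hypoCone (v : N) (c : ℝ) (hc : 0 < c)
    (p : ((N →L[𝕜] N) × ProjTensor 𝕜 A (N →L[𝕜] N)) × ℝ) (hp : p ∈ hypoCone D F v) :
    (((c : 𝕜) • p.1, c * p.2) : ((N →L[𝕜] N) × ProjTensor 𝕜 A (N →L[𝕜] N)) × ℝ)
      ∈ hypoCone D F v := by
  obtain ⟨E, _, _, _, V, ⟨Y, X⟩, hX, hV, hcX, hs⟩ := hp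
  have hsq : Real.sqrt c ^ 2 = c := Real.sq_sqrt hc.le
  refine ⟨E, inferInstance, inferInstance, inferInstance, ((Real.sqrt c : ℝ) : 𝕜) • V, (Y, X), hX,
    ?_, ?_, ?_⟩
  · have h1 : (((Real.sqrt c : ℝ) : 𝕜) • V).adjoint ∘L (((Real.sqrt c : ℝ) : 𝕜) • V)
        = (c : 𝕜) • (V.adjoint ∘L V) := by
      ext x
      simp only [map_smulₛₗ, RCLike.conj_ofReal, ContinuousLinearMap.comp_apply,
        smul_apply, smul_smul, RingHom.id_apply]
      rw [← RCLike.ofReal_mul, ← sq, hsq]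
    rw [h1]
    rw [ContinuousLinearMap.le_def] at hV ⊢
    rw [Prod.smul_fst, ← smul_sub]
    exact hV.smul_of_nonneg (by exact_mod_cast hc.le)
  · change compress _ X = _
    rw [compress_smul, hsq]
    exact congrArg (fun z => (c : 𝕜) • z) hcX
  · simp only [smul_apply, map_smul, inner_smul_left, inner_smul_right,
      RCLike.conj_ofReal]
    rw [← mul_assoc, ← RCLike.ofReal_mul, ← sq, hsq, RCLike.re_ofReal_mul]
    exact mul_le_mul_of_nonneg_left hs hc.le

/-- The Jensen inequality for contractions with `V* X V` in the domain. -/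
theorem sandwich_le_of_contraction (hDsum : ClosedUnderSums D) (hFsum : PreservesSums D F)
    (hFjensen : IsJensen D F)
    (hD0 : ∀ (E : Type u) [NormedAddCommGroup E] [InnerProductSpace 𝕜 E] [CompleteSpace E],
      (0 : ProjTensor 𝕜 A (E →L[𝕜] E)) ∈ D E)
    (hFpos : IsPositiveOn D F)
    {E : Type u} [NormedAddCommGroup E] [InnerProductSpace 𝕜 E] [CompleteSpace E]
    (V : N →L[𝕜] E) (hV : V.adjoint ∘L V ≤ 1) (X : ProjTensor 𝕜 A (E →L[𝕜] E)) (hX : X ∈ D E)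
    (hVX : compress V X ∈ D N) : sandwich V V (F E X) ≤ F N (compress V X) := by
  -- The defect `1 - V*V` factors as `S*S`, so the column `(V, S)` is an isometry that compresses `X
  -- ⊕ 0` to `V*XV`.
  obtain ⟨K, _, _, _, S, hS⟩ := exists_adjoint_comp_self_eq _ hV
  have hsum : (column V S).adjoint ∘L column V S = 1 := by
    rw [adjoint_column_comp_column, hS]; abel
  let W : N →ₗᵢ[𝕜] WithLp 2 (E × K) :=
    { toLinearMap := (column V S).toLinearMap
      norm_map' := fun x => by
        have h1 : ‖column V S x‖ ^ 2 = ‖x‖ ^ 2 := by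
          rw [← inner_self_eq_norm_sq (𝕜 := 𝕜), ← ContinuousLinearMap.adjoint_inner_right,
            ← ContinuousLinearMap.comp_apply, hsum, ← inner_self_eq_norm_sq (𝕜 := 𝕜)]
          rfl
        exact (pow_left_inj₀ (norm_nonneg _) (norm_nonneg _) two_ne_zero).1 h1 }
  have hW : W.toContinuousLinearMap = column V S := rfl
  have hcomp : compress W.toContinuousLinearMap
      (tensorSum X (0 : ProjTensor 𝕜 A (K →L[𝕜] K))) = compress V X := by
    rw [hW, compress_column_tensorSum, map_zero, add_zero]
  have hj := hFjensen N _ W _ (hDsum E K X hX 0 (hD0 K)) (by rw [hcomp]; exact hVX)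
  rw [hcomp, hFsum E K X hX 0 (hD0 K), hW, sandwich_column_opSum] at hj
  refine le_trans ?_ hj
  -- Jensen yields `V*F(X)V + S*F(0)S`; the second summand is positive and may be dropped.
  have h0 := sandwich_mono S (hFpos K 0 (hD0 K)).1
  rw [map_zero, ContinuousLinearMap.nonneg_iff_isPositive] at h0
  rw [ContinuousLinearMap.le_def, add_sub_cancel_left]
  exact h0

/-- For `c = 1` the operator `V` is a contraction with `V*XV = a`, and the contractive Jensen
inequality applies; positive `c` follows by scaling. -/
theorem le_of_mem_hypoCone (hDsum : ClosedUnderSums D) (hFsum : PreservesSums D F)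
    (hFjensen : IsJensen D F)
    (hD0 : ∀ (E : Type u) [NormedAddCommGroup E] [InnerProductSpace 𝕜 E] [CompleteSpace E],
      (0 : ProjTensor 𝕜 A (E →L[𝕜] E)) ∈ D E)
    (hFpos : IsPositiveOn D F) (a : ProjTensor 𝕜 A (N →L[𝕜] N)) (ha : a ∈ D N)
    (v : N) (hv : ‖v‖ = 1) (c r : ℝ)
    (h : ((((c : 𝕜) • ((1 : N →L[𝕜] N), a)), r) :
      ((N →L[𝕜] N) × ProjTensor 𝕜 A (N →L[𝕜] N)) × ℝ) ∈ hypoCone D F v) :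
    r ≤ c * RCLike.re (inner 𝕜 v (F N a v) : 𝕜) := by
  have key : ∀ r : ℝ, ((((1 : N →L[𝕜] N), a), r) :
      ((N →L[𝕜] N) × ProjTensor 𝕜 A (N →L[𝕜] N)) × ℝ) ∈ hypoCone D F v →
      r ≤ RCLike.re (inner 𝕜 v (F N a v) : 𝕜) := by
    rintro r ⟨E, _, _, _, V, ⟨Y, X⟩, ⟨hX, hY⟩, hV, hcX, hs⟩
    have h1 := sandwich_le_of_contraction hDsum hFsum hFjensen hD0 hFpos V hV X hX
      (by rw [show compress V X = a from hcX]; exact ha)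
    rw [show compress V X = a from hcX] at h1
    have h2 := ContinuousLinearMap.IsPositive.re_inner_nonneg_right h1 v
    have h3 := ContinuousLinearMap.IsPositive.re_inner_nonneg_right hY (V v)
    rw [sub_apply, inner_sub_right, map_sub] at h2 h3
    rw [inner_sandwich] at h2
    simp only at hs h3
    linarith
  -- Testing `V*V ≤ c` at the unit vector `v` gives `‖V v‖² ≤ c`, so `c = 0` forces `V v = 0`.
  have hc0 : 0 ≤ c ∧ (c = 0 → r ≤ 0) := by
    obtain ⟨E, _, _, _, V, ⟨Y, X⟩, -, hV, -, hs⟩ := h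
    have h1 := ContinuousLinearMap.IsPositive.re_inner_nonneg_right hV v
    simp only [sub_apply, Prod.smul_fst, smul_apply, inner_sub_right, inner_smul_right,
      ContinuousLinearMap.comp_apply, ContinuousLinearMap.adjoint_inner_right,
      inner_self_eq_norm_sq_to_K, one_apply_eq_self, hv] at h1
    rw [map_sub, RCLike.re_ofReal_mul, ← RCLike.ofReal_pow, ← RCLike.ofReal_pow,
      RCLike.ofReal_re, RCLike.ofReal_re, one_pow, mul_one] at h1
    refine ⟨by nlinarith [sq_nonneg ‖V v‖], fun hc => ?_⟩
    have h2 : ‖V v‖ = 0 := by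
      have : ‖V v‖ ^ 2 ≤ 0 := by linarith
      exact pow_eq_zero_iff two_ne_zero |>.1 (le_antisymm this (sq_nonneg _))
    rw [norm_eq_zero] at h2
    simpa [h2] using hs
  rcases hc0.1.eq_or_lt with hc | hc
  · rw [← hc, zero_mul]; exact hc0.2 hc.symm
  · have h1 := smul_mem_hypoCone v c⁻¹ (inv_pos.2 hc) _ h
    simp only [smul_smul, ← RCLike.ofReal_mul, inv_mul_cancel₀ hc.ne', RCLike.ofReal_one,
      one_smul] at h1
    have h2 := key _ h1
    rwa [inv_mul_le_iff₀ hc] at h2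

variable [StarAddMonoid A] [StarModule 𝕜 A] [ContinuousStar A]

/-- Height zero is attained because `F` is positive at the point that is compressed to `X`. -/
theorem mem_hypoCone_of_mem_hull (hFpos : IsPositiveOn D F)
    (v : N) (Z : N →L[𝕜] N) (X : ProjTensor 𝕜 A (N →L[𝕜] N)) (hX : X ∈ hull D N) (hZ : 1 ≤ Z) :
    (((Z, X), 0) : ((N →L[𝕜] N) × ProjTensor 𝕜 A (N →L[𝕜] N)) × ℝ) ∈ hypoCone D F v := by
  obtain ⟨K, _, _, _, V, X', hX', rfl⟩ := hX
  refine ⟨K, inferInstance, inferInstance, inferInstance, V.toContinuousLinearMap, (F K X', X'),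
    ⟨hX', le_rfl⟩, ?_, rfl, ?_⟩
  · refine le_of_eq_of_le ?_ hZ
    ext x
    refine ext_inner_left 𝕜 fun y => ?_
    rw [ContinuousLinearMap.comp_apply, ContinuousLinearMap.adjoint_inner_right]
    exact V.inner_map_map y x
  · exact ContinuousLinearMap.IsPositive.re_inner_nonneg_right
      ((ContinuousLinearMap.nonneg_iff_isPositive _).1 (hFpos K X' hX').1) _

/-- Small multiples of self-adjoint elements can be added to a multiple `> 1` of an interior
point without leaving the set. -/
theorem exists_add_mem_of_mem_saInterior {E : Type*} [NormedAddCommGroup E]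
    [InnerProductSpace 𝕜 E] [CompleteSpace E] {S : Set (ProjTensor 𝕜 A (E →L[𝕜] E))}
    {a : ProjTensor 𝕜 A (E →L[𝕜] E)} (ha : a ∈ saInterior S) :
    ∃ ε ρ : ℝ, 0 < ε ∧ 0 < ρ ∧ ∀ X, adj X = X → ‖X‖ < ρ → ((1 + ε : ℝ) : 𝕜) • a + X ∈ S := by
  obtain ⟨haa, ρ, hρ, h⟩ := ha
  -- Half of the radius `ρ` is spent on `ε a` and half on `X`; the `+ 1` covers `a = 0`.
  refine ⟨ρ / (2 * (‖a‖ + 1)), ρ / 2, by positivity, by positivity, fun X hX hn => h _ ?_ ?_⟩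
  · rw [map_add, map_smulₛₗ, RCLike.conj_ofReal, haa, hX]
  · have h1 : ((1 + ρ / (2 * (‖a‖ + 1)) : ℝ) : 𝕜) • a + X - a
        = ((ρ / (2 * (‖a‖ + 1)) : ℝ) : 𝕜) • a + X := by
      rw [RCLike.ofReal_add, add_smul, RCLike.ofReal_one, one_smul]; abel
    rw [h1]
    refine (norm_add_le _ _).trans_lt ?_
    rw [norm_smul, RCLike.norm_ofReal, abs_of_pos (by positivity)]
    have h2 : ρ / (2 * (‖a‖ + 1)) * ‖a‖ ≤ ρ / 2 := by
      rw [div_mul_eq_mul_div, div_le_div_iff₀ (by positivity) (by positivity)]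
      nlinarith [norm_nonneg a]
    linarith

theorem isPositive_norm_smul_one_add (Z : N →L[𝕜] N) (hZ : star Z = Z) (c : ℝ) (hc : ‖Z‖ ≤ c) :
    (Z + (c : 𝕜) • (1 : N →L[𝕜] N)).IsPositive := by
  rw [ContinuousLinearMap.isPositive_def']
  constructor
  · rw [IsSelfAdjoint, star_add, star_smul, star_one, hZ, RCLike.star_def, RCLike.conj_ofReal]
  · intro x
    rw [ContinuousLinearMap.reApplyInnerSelf_apply, add_apply, inner_add_left, smul_apply,
      inner_smul_left, RCLike.conj_ofReal, one_apply_eq_self, map_add,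
      RCLike.re_ofReal_mul, inner_self_eq_norm_sq]
    have h1 : |RCLike.re (inner 𝕜 (Z x) x : 𝕜)| ≤ c * ‖x‖ ^ 2 := by
      refine (RCLike.abs_re_le_norm _).trans ((norm_inner_le_norm _ _).trans ?_)
      rw [sq, ← mul_assoc]
      exact mul_le_mul_of_nonneg_right ((Z.le_opNorm x).trans
        (mul_le_mul_of_nonneg_right hc (norm_nonneg x))) (norm_nonneg x)
    linarith [neg_abs_le (RCLike.re (inner 𝕜 (Z x) x : 𝕜))]

/-- For large `m`, `(1 + ε) a + X / m` stays in the hull and `(1 + ε) + Z / m ≥ 1`; scaling by `m`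
gives `c = m (1 + ε)`. -/
theorem exists_add_smul_mem_hypoCone (hFpos : IsPositiveOn D F)
    (a : ProjTensor 𝕜 A (N →L[𝕜] N)) (haint : a ∈ saInterior (hull D N)) (v : N)
    (Z : N →L[𝕜] N) (hZ : star Z = Z) (X : ProjTensor 𝕜 A (N →L[𝕜] N)) (hX : adj X = X) :
    ∃ c : ℝ, (((Z, X) + (c : 𝕜) • ((1 : N →L[𝕜] N), a), 0) :
      ((N →L[𝕜] N) × ProjTensor 𝕜 A (N →L[𝕜] N)) × ℝ) ∈ hypoCone D F v := by
  obtain ⟨ε, ρ, hε, hρ, h⟩ := exists_add_mem_of_mem_saInterior haint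
  obtain ⟨m, hm1, hm2⟩ : ∃ m : ℝ, ‖X‖ / ρ < m ∧ ‖Z‖ / ε < m := by
    obtain ⟨m, hm⟩ := exists_gt (max (‖X‖ / ρ) (‖Z‖ / ε))
    exact ⟨m, (le_max_left _ _).trans_lt hm, (le_max_right _ _).trans_lt hm⟩
  have hm : 0 < m := lt_of_le_of_lt (by positivity) hm1
  have h1 : ((1 + ε : ℝ) : 𝕜) • a + ((m⁻¹ : ℝ) : 𝕜) • X ∈ hull D N := by
    refine h _ (by rw [map_smulₛₗ, RCLike.conj_ofReal, hX]) ?_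
    rw [norm_smul, RCLike.norm_ofReal, abs_of_pos (inv_pos.2 hm), inv_mul_lt_iff₀ hm]
    exact (div_lt_iff₀ hρ).1 hm1
  have hmm : ((m : ℝ) : 𝕜) * ((m⁻¹ : ℝ) : 𝕜) = 1 := by
    rw [← RCLike.ofReal_mul, mul_inv_cancel₀ hm.ne', RCLike.ofReal_one]
  have h2 := smul_mem_hypoCone v m hm _ (mem_hypoCone_of_mem_hull hFpos v
    (((m⁻¹ : ℝ) : 𝕜) • Z + ((1 + ε : ℝ) : 𝕜) • (1 : N →L[𝕜] N)) _ h1 (by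
      have hn : ‖((m⁻¹ : ℝ) : 𝕜) • Z‖ ≤ ε := by
        rw [norm_smul, RCLike.norm_ofReal, abs_of_pos (inv_pos.2 hm), inv_mul_le_iff₀ hm]
        exact ((div_lt_iff₀ hε).1 hm2).le
      have := isPositive_norm_smul_one_add (((m⁻¹ : ℝ) : 𝕜) • Z) (by
        rw [star_smul, hZ, RCLike.star_def, RCLike.conj_ofReal]) ε hn
      rw [ContinuousLinearMap.le_def]
      convert this using 1
      rw [RCLike.ofReal_add, add_smul, RCLike.ofReal_one, one_smul]; abel))
  refine ⟨m * (1 + ε), ?_⟩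
  convert h2 using 2
  · simp only [Prod.smul_mk, Prod.mk_add_mk, smul_add, smul_smul, hmm, one_smul]
    rw [RCLike.ofReal_mul, add_comm X]
  · rw [mul_zero]

end Cone

/-! ### The supporting functionals -/

section Separation

variable {𝕜 : Type*} [RCLike 𝕜]
  {A : Type w} [NormedAddCommGroup A] [NormedSpace 𝕜 A]
  [StarAddMonoid A] [StarModule 𝕜 A] [ContinuousStar A]
  {D : SetFamily.{u} 𝕜 A} {F : FunFamily.{u} 𝕜 A}
  {N : Type u} [NormedAddCommGroup N] [InnerProductSpace 𝕜 N] [CompleteSpace N]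

theorem star_adjoint_comp {E : Type*} [NormedAddCommGroup E] [InnerProductSpace 𝕜 E]
    [CompleteSpace E] (W V : N →L[𝕜] E) :
    star (W.adjoint ∘L V) = V.adjoint ∘L W := by
  rw [ContinuousLinearMap.star_eq_adjoint, ContinuousLinearMap.adjoint_comp,
    ContinuousLinearMap.adjoint_adjoint]

/-- The functionals `T` and `ℓ` dominate the hypograph of `F` in the direction `v`:
`⟨V v, Y V v⟩ ≤ T(V* V) + ℓ(V* X V)` for all `(Y, X)` in the hypograph and all bounded `V`. -/
def Dominates (D : SetFamily.{u} 𝕜 A) (F : FunFamily.{u} 𝕜 A) (v : N) (T : OpDual 𝕜 N)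
    (ℓ : StrongDual 𝕜 (ProjTensor 𝕜 A (N →L[𝕜] N))) : Prop :=
  ∀ (E : Type u) [NormedAddCommGroup E] [InnerProductSpace 𝕜 E] [CompleteSpace E]
    (V : N →L[𝕜] E) (Y : E →L[𝕜] E) (X : ProjTensor 𝕜 A (E →L[𝕜] E)),
    (Y, X) ∈ hypo D F E → RCLike.re (inner 𝕜 (V v) (Y (V v)) : 𝕜)
      ≤ RCLike.re (T (V.adjoint ∘L V)) + RCLike.re (ℓ (compress V X))

/-- The pair of functionals supporting the hypograph of `F` at `(F(a), a)`. -/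
theorem exists_supporting_functionals (hDsa : IsSelfAdjointFamily D)
    (hDsum : ClosedUnderSums D) (hFsum : PreservesSums D F) (hFjensen : IsJensen D F)
    (hD0 : ∀ (E : Type u) [NormedAddCommGroup E] [InnerProductSpace 𝕜 E] [CompleteSpace E],
      (0 : ProjTensor 𝕜 A (E →L[𝕜] E)) ∈ D E)
    (hFpos : IsPositiveOn D F) (a : ProjTensor 𝕜 A (N →L[𝕜] N)) (ha : a ∈ D N)
    (haint : a ∈ saInterior (hull D N)) (v : N) (hv : ‖v‖ = 1) :
    ∃ (T : OpDual 𝕜 N) (ℓ : StrongDual 𝕜 (ProjTensor 𝕜 A (N →L[𝕜] N))),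
      IsPositiveFunctional T ∧ (∀ X, ℓ (adj X) = conj (ℓ X)) ∧
      T 1 + ℓ a = inner 𝕜 v (F N a v) ∧ Dominates D F v T ℓ := by
  let J : ((N →L[𝕜] N) × ProjTensor 𝕜 A (N →L[𝕜] N)) →ₗ⋆[𝕜]
      (N →L[𝕜] N) × ProjTensor 𝕜 A (N →L[𝕜] N) :=
    { toFun := fun p => (star p.1, adj p.2)
      map_add' := fun p q => by simp only [Prod.fst_add, Prod.snd_add, star_add, map_add,
        Prod.mk_add_mk]
      map_smul' := fun c p => by
        simp only [Prod.smul_fst, Prod.smul_snd, star_smul, map_smulₛₗ, Prod.smul_mk]; rfl }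
  have hJ : ∀ (Z : N →L[𝕜] N) (X : ProjTensor 𝕜 A (N →L[𝕜] N)), J (Z, X) = (star Z, adj X) :=
    fun Z X => rfl
  -- With `V = 0` the slack `V*V ≤ Z` alone puts `Z ≥ 0` in the cone; this makes `T` positive.
  have hpos0 : ∀ Z : N →L[𝕜] N, 0 ≤ Z →
      (((Z, 0), 0) : ((N →L[𝕜] N) × ProjTensor 𝕜 A (N →L[𝕜] N)) × ℝ) ∈ hypoCone D F v :=
    fun Z hZ => ⟨N, inferInstance, inferInstance, inferInstance, 0, (F N 0, 0),
      ⟨hD0 N, le_rfl⟩, by rw [ContinuousLinearMap.comp_zero]; exact hZ, map_zero _, by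
        rw [zero_apply, inner_zero_left, map_zero]⟩
  have hv0 : v ≠ 0 := fun h => by rw [h, norm_zero] at hv; exact zero_ne_one hv
  obtain ⟨φ, hφJ, hφe, hφC⟩ := exists_hermitian_functional J
    (fun p => by
      change J (star p.1, adj p.2) = p
      rw [hJ, star_star, adj_adj])
    (hypoCone D F v)
    (hpos0 0 le_rfl)
    (fun p hp q hq => add_mem_hypoCone hDsum hFsum v p q hp hq) (smul_mem_hypoCone v)
    ((1 : N →L[𝕜] N), a) (by rw [hJ, star_one, haint.1])
    (fun h => hv0 (congrArg (fun R : N →L[𝕜] N => R v) (Prod.mk_eq_zero.1 h).1))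
    (RCLike.re (inner 𝕜 v (F N a v) : 𝕜))
    (fun c r h => le_of_mem_hypoCone hDsum hFsum hFjensen hD0 hFpos a ha v hv c r h)
    (by
      rintro ⟨Z, X⟩ h
      rw [hJ, Prod.mk.injEq] at h
      obtain ⟨c, hc⟩ := exists_add_smul_mem_hypoCone hFpos a haint v Z h.1 X h.2
      exact ⟨c, 0, hc⟩)
  let T₀ : (N →L[𝕜] N) →ₗ[𝕜] 𝕜 := φ ∘ₗ LinearMap.inl 𝕜 _ _
  let ℓ₀ : ProjTensor 𝕜 A (N →L[𝕜] N) →ₗ[𝕜] 𝕜 := φ ∘ₗ LinearMap.inr 𝕜 _ _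
  have hsplit : ∀ (Z : N →L[𝕜] N) (X : ProjTensor 𝕜 A (N →L[𝕜] N)), φ (Z, X) = T₀ Z + ℓ₀ X :=
    fun Z X => by
      rw [LinearMap.comp_apply, LinearMap.comp_apply, ← map_add]
      simp
  have hTherm : ∀ Z, T₀ (star Z) = conj (T₀ Z) := fun Z => by
    have := hφJ (Z, 0)
    rwa [hJ, map_zero, hsplit, hsplit, map_zero, add_zero, add_zero] at this
  have hℓherm : ∀ X, ℓ₀ (adj X) = conj (ℓ₀ X) := fun X => by
    have := hφJ (0, X)
    rwa [hJ, star_zero, hsplit, hsplit, map_zero, zero_add, zero_add] at this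
  have hTpos : ∀ Z : N →L[𝕜] N, 0 ≤ Z → 0 ≤ RCLike.re (T₀ Z) := fun Z hZ => by
    have hsa : star Z = Z := ((ContinuousLinearMap.nonneg_iff_isPositive Z).1 hZ).isSelfAdjoint
    have := hφC _ (hpos0 Z hZ) (by rw [hJ, hsa, map_zero])
    rwa [hsplit, map_zero, add_zero] at this
  have hC : ∀ (Z : N →L[𝕜] N) (X : ProjTensor 𝕜 A (N →L[𝕜] N)) (s : ℝ), star Z = Z → adj X = X →
      (((Z, X), s) : ((N →L[𝕜] N) × ProjTensor 𝕜 A (N →L[𝕜] N)) × ℝ) ∈ hypoCone D F v →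
      s ≤ RCLike.re (T₀ Z) + RCLike.re (ℓ₀ X) := fun Z X s hZ hX h => by
    have := hφC _ h (by rw [hJ, hZ, hX])
    rwa [hsplit, map_add] at this
  -- A hermitian `Z` with `‖Z‖ < 1` satisfies `Z + 1 ≥ 0`, hence `T(Z) ≥ -T(1)`.
  obtain ⟨M₁, hM₁⟩ := exists_bound_of_hermitian
    (starL 𝕜 : (N →L[𝕜] N) ≃L⋆[𝕜] (N →L[𝕜] N)).toContinuousLinearMap
    (fun Z => star_star Z) T₀ hTherm 1 (RCLike.re (T₀ 1)) one_pos (fun Z hZ hn => by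
      have h1 := isPositive_norm_smul_one_add Z hZ 1 hn.le
      rw [← ContinuousLinearMap.nonneg_iff_isPositive] at h1
      have h2 := hTpos _ h1
      rw [RCLike.ofReal_one, one_smul, map_add, map_add] at h2
      linarith)
  obtain ⟨ε, ρ, hε, hρ, hint⟩ := exists_add_mem_of_mem_saInterior haint
  -- For small hermitian `X` the point `(1 + ε) a + X` lies in the hull, so `0 ≤ T(1) + ℓ((1 + ε) a)
  -- + ℓ(X)`.
  obtain ⟨M₂, hM₂⟩ := exists_bound_of_hermitian adj adj_adj ℓ₀ hℓherm ρ
    (RCLike.re (T₀ 1) + RCLike.re (ℓ₀ (((1 + ε : ℝ) : 𝕜) • a))) hρ (fun X hX hn => by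
      have h1 := hC _ _ _ (star_one _)
        (by rw [map_add, hX, map_smulₛₗ, RCLike.conj_ofReal, haint.1])
        (mem_hypoCone_of_mem_hull hFpos v 1 _ (hint X hX hn) le_rfl)
      rw [ℓ₀.map_add, map_add] at h1
      linarith)
  refine ⟨T₀.mkContinuous M₁ hM₁, ℓ₀.mkContinuous M₂ hM₂, ⟨hTherm, hTpos⟩, hℓherm, ?_, ?_⟩
  · change T₀ 1 + ℓ₀ a = _
    rw [← hsplit, hφe]
    -- Positivity of `F(a)` makes `⟨v, F(a) v⟩` real, so it equals the real number used for the
    -- separation.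
    have hp := (ContinuousLinearMap.nonneg_iff_isPositive _).1 (hFpos N a ha).1
    refine RCLike.conj_eq_iff_re.1 ?_
    rw [inner_conj_symm, hp.inner_left_eq_inner_right]
  · intro E _ _ _ V Y X hYX
    refine hC _ _ _ (star_adjoint_comp V V) (by rw [adj_compress, hDsa E X hYX.1])
      ⟨E, inferInstance, inferInstance, inferInstance, V, (Y, X), hYX, le_rfl, rfl, le_rfl⟩

end Separation

/-! ### Sesquilinearity and symmetry of the form -/

section FormOfPencil

variable {𝕜 : Type*} [RCLike 𝕜]
  {A : Type w} [NormedAddCommGroup A] [NormedSpace 𝕜 A]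
  {N : Type u} [NormedAddCommGroup N] [InnerProductSpace 𝕜 N] [CompleteSpace N]
  {E : Type u} [NormedAddCommGroup E] [InnerProductSpace 𝕜 E] [CompleteSpace E]

theorem form_add_right (W V V' : N →L[𝕜] E) (Φ : ProjTensor 𝕜 (OpDual 𝕜 N) (E →L[𝕜] E)) :
    form W (V + V') Φ = form W V Φ + form W V' Φ := by
  have : form W (V + V') = form W V + form W V' := projTensor_ext fun τ Z => by
    rw [add_apply, form_tmul, form_tmul, form_tmul, ← map_add]
    congr 1
    simp only [ContinuousLinearMap.comp_add]
  rw [this]; rfl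

theorem form_smul_right (W V : N →L[𝕜] E) (c : 𝕜)
    (Φ : ProjTensor 𝕜 (OpDual 𝕜 N) (E →L[𝕜] E)) :
    form W (c • V) Φ = c * form W V Φ := by
  have : form W (c • V) = c • form W V := projTensor_ext fun τ Z => by
    rw [smul_apply, form_tmul, form_tmul, ← map_smul]
    congr 1
    simp only [ContinuousLinearMap.comp_smul]
  rw [this]; rfl

theorem sqNorm_add_add_sqNorm_sub (T : OpDual 𝕜 N) (V W : N →L[𝕜] E) :
    sqNorm T (V + W) + sqNorm T (V - W) = 2 * (sqNorm T V + sqNorm T W) := by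
  have h : (V + W).adjoint ∘L (V + W) + (V - W).adjoint ∘L (V - W)
      = (2 : ℕ) • (V.adjoint ∘L V + W.adjoint ∘L W) := by
    simp only [map_add, map_sub, ContinuousLinearMap.add_comp, ContinuousLinearMap.comp_add,
      ContinuousLinearMap.sub_comp, ContinuousLinearMap.comp_sub]
    abel
  rw [sqNorm, sqNorm, ← map_add, ← map_add, h, map_nsmul, map_nsmul, map_add, map_add,
    nsmul_eq_mul, sqNorm, sqNorm]
  push_cast; ring

theorem sqNorm_smul (T : OpDual 𝕜 N) (c : 𝕜) (V : N →L[𝕜] E) :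
    sqNorm T (c • V) = ‖c‖ ^ 2 * sqNorm T V := by
  have h : (c • V).adjoint ∘L (c • V) = ((‖c‖ ^ 2 : ℝ) : 𝕜) • (V.adjoint ∘L V) := by
    rw [map_smulₛₗ, ContinuousLinearMap.smul_comp, ContinuousLinearMap.comp_smul, smul_smul,
      RCLike.conj_mul, RCLike.ofReal_pow]
  rw [sqNorm, h, T.map_smul, smul_eq_mul, RCLike.re_ofReal_mul, sqNorm]

variable [StarAddMonoid A] [StarModule 𝕜 A] [ContinuousStar A]

theorem form_pencil_hermitian (T : OpDual 𝕜 N) (hT : ∀ Z, T (star Z) = conj (T Z)) (v : N)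
    (ℓ : StrongDual 𝕜 (ProjTensor 𝕜 A (N →L[𝕜] N))) (hℓ : ∀ X, ℓ (adj X) = conj (ℓ X))
    (Y : E →L[𝕜] E) (hY : IsSelfAdjoint Y) (X : ProjTensor 𝕜 A (E →L[𝕜] E)) (hX : adj X = X)
    (W V : N →L[𝕜] E) :
    form W V (pencil T v (dualMap ℓ) E (Y, X))
      = conj (form V W (pencil T v (dualMap ℓ) E (Y, X))) := by
  rw [form_pencil_dualMap, form_pencil_dualMap, map_add, map_sub, ← hT, star_adjoint_comp,
    inner_conj_symm, ← hℓ, ← mapRight_adj _ _ (sandwich_star W V), hX]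
  congr 2
  rw [← ContinuousLinearMap.adjoint_inner_left, ← ContinuousLinearMap.star_eq_adjoint, hY.star_eq]

end FormOfPencil

/-! ### Consequences of domination -/

section Estimates

variable {𝕜 : Type*} [RCLike 𝕜]
  {A : Type w} [NormedAddCommGroup A] [NormedSpace 𝕜 A]
  [StarAddMonoid A] [StarModule 𝕜 A] [ContinuousStar A]
  {D : SetFamily.{u} 𝕜 A} {F : FunFamily.{u} 𝕜 A}
  {N : Type u} [NormedAddCommGroup N] [InnerProductSpace 𝕜 N] [CompleteSpace N]
  {v : N} {T : OpDual 𝕜 N} {ℓ : StrongDual 𝕜 (ProjTensor 𝕜 A (N →L[𝕜] N))}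

theorem adjoint_comp_isometry {E K : Type*} [NormedAddCommGroup E] [InnerProductSpace 𝕜 E]
    [CompleteSpace E] [NormedAddCommGroup K] [InnerProductSpace 𝕜 K] [CompleteSpace K]
    (W : E →ₗᵢ[𝕜] K) (V : N →L[𝕜] E) :
    (W.toContinuousLinearMap ∘L V).adjoint ∘L (W.toContinuousLinearMap ∘L V)
      = V.adjoint ∘L V := by
  ext x
  refine ext_inner_left 𝕜 fun y => ?_
  rw [ContinuousLinearMap.comp_apply, ContinuousLinearMap.comp_apply,
    ContinuousLinearMap.comp_apply, ContinuousLinearMap.adjoint_inner_right,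
    ContinuousLinearMap.adjoint_inner_right]
  exact W.inner_map_map _ _

theorem re_inner_le_of_mem_hypoHull
    (h : Dominates D F v T ℓ)
    {E : Type u} [NormedAddCommGroup E] [InnerProductSpace 𝕜 E] [CompleteSpace E]
    (V : N →L[𝕜] E) (Y : E →L[𝕜] E) (X : ProjTensor 𝕜 A (E →L[𝕜] E))
    (hYX : (Y, X) ∈ hypoHull D F E) : RCLike.re (inner 𝕜 (V v) (Y (V v)) : 𝕜)
      ≤ RCLike.re (T (V.adjoint ∘L V)) + RCLike.re (ℓ (compress V X)) := by
  obtain ⟨K, _, _, _, W, ⟨Y', X'⟩, hp, hq⟩ := hYX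
  rw [Prod.mk.injEq] at hq
  obtain ⟨rfl, rfl⟩ := hq
  have := h K (W.toContinuousLinearMap ∘L V) Y' X' hp
  rwa [adjoint_comp_isometry, ← compress_compress, ContinuousLinearMap.comp_apply,
    ← inner_sandwich] at this

theorem nonneg_of_mem_hull (hFpos : IsPositiveOn D F)
    (h : Dominates D F v T ℓ)
    {E : Type u} [NormedAddCommGroup E] [InnerProductSpace 𝕜 E] [CompleteSpace E]
    (V : N →L[𝕜] E) (X : ProjTensor 𝕜 A (E →L[𝕜] E)) (hX : X ∈ hull D E) :
    0 ≤ RCLike.re (T (V.adjoint ∘L V)) + RCLike.re (ℓ (compress V X)) := by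
  obtain ⟨K, _, _, _, W, X', hX', rfl⟩ := hX
  refine le_trans ?_ (re_inner_le_of_mem_hypoHull h V
    (sandwich W.toContinuousLinearMap W.toContinuousLinearMap (F K X')) _
    ⟨K, _, _, _, W, (F K X', X'), ⟨hX', le_rfl⟩, rfl⟩)
  rw [inner_sandwich]
  exact ContinuousLinearMap.IsPositive.re_inner_nonneg_right
    ((ContinuousLinearMap.nonneg_iff_isPositive _).1 (hFpos K X' hX').1) _

theorem exists_mul_sqNorm_le (hFpos : IsPositiveOn D F)
    (h : Dominates D F v T ℓ)
    {E : Type u} [NormedAddCommGroup E] [InnerProductSpace 𝕜 E] [CompleteSpace E]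
    (X : ProjTensor 𝕜 A (E →L[𝕜] E)) (hX : X ∈ saInterior (hull D E)) :
    ∃ ε : ℝ, 0 < ε ∧ ∀ V : N →L[𝕜] E,
      ε * sqNorm T V ≤ RCLike.re (form V V (pencil T v (dualMap ℓ) E (0, X))) := by
  obtain ⟨ε, ρ, hε, hρ, hint⟩ := exists_add_mem_of_mem_saInterior hX
  -- As `(1 + ε) X` is in the hull, `T + (1 + ε) ℓ ≥ 0` at `V`, and `(1 + ε)(T + ℓ) = ε T + (T + (1
  -- + ε) ℓ)`.
  refine ⟨ε / (1 + ε), by positivity, fun V => ?_⟩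
  have h1 := hint 0 (map_zero _) (by rwa [norm_zero])
  rw [add_zero] at h1
  have h2 := nonneg_of_mem_hull hFpos h V _ h1
  rw [map_smul, ℓ.map_smul, smul_eq_mul, RCLike.re_ofReal_mul] at h2
  rw [form_pencil_dualMap, zero_apply, inner_zero_right, sub_zero, map_add, sqNorm,
    div_mul_eq_mul_div, div_le_iff₀ (by positivity)]
  change _ ≤ (_ + RCLike.re (ℓ (compress V X))) * _
  linarith

/-- Each term of the form is controlled on the diagonal by `T(V*V)`; Cauchy–Schwarz for dominated
hermitian forms does the rest. -/
theorem exists_norm_form_sq_le (hFpos : IsPositiveOn D F)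
    (hD0 : ∀ (E : Type u) [NormedAddCommGroup E] [InnerProductSpace 𝕜 E] [CompleteSpace E],
      (0 : ProjTensor 𝕜 A (E →L[𝕜] E)) ∈ D E)
    (hT : ∀ Z, T (star Z) = conj (T Z)) (hℓ : ∀ X, ℓ (adj X) = conj (ℓ X))
    (h : Dominates D F v T ℓ)
    (E : Type u) [NormedAddCommGroup E] [InnerProductSpace 𝕜 E] [CompleteSpace E]
    (h0 : 0 ∈ saInterior (hull D E)) :
    ∃ C : ℝ, ∀ (Y : E →L[𝕜] E) (X : ProjTensor 𝕜 A (E →L[𝕜] E)),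
      IsSelfAdjoint Y → adj X = X → ∀ W V : N →L[𝕜] E,
        ‖form W V (pencil T v (dualMap ℓ) E (Y, X))‖ ^ 2
          ≤ (C * (1 + ‖Y‖ + ‖X‖)) ^ 2 * (sqNorm T W * sqNorm T V) := by
  obtain ⟨k, hk0, hk⟩ := exists_norm_sq_le_re_inner (F E 0) (hFpos E 0 (hD0 E))
  obtain ⟨-, ρ, hρ, hint⟩ := h0
  -- Domination at `(F(0), 0)`, where invertibility of `F(0)` provides the lower bound.
  have hvT : ∀ V : N →L[𝕜] E, ‖V v‖ ^ 2 ≤ k * sqNorm T V := fun V => by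
    have h1 := h E V (F E 0) 0 ⟨hD0 E, le_rfl⟩
    rw [map_zero, map_zero, map_zero, add_zero] at h1
    exact (hk (V v)).trans (mul_le_mul_of_nonneg_left h1 hk0)
  have hS : ∀ V : N →L[𝕜] E, 0 ≤ sqNorm T V := fun V => by
    have h1 := h E V (F E 0) 0 ⟨hD0 E, le_rfl⟩
    rw [map_zero, map_zero, map_zero, add_zero] at h1
    exact (ContinuousLinearMap.IsPositive.re_inner_nonneg_right
      ((ContinuousLinearMap.nonneg_iff_isPositive _).1 (hFpos E 0 (hD0 E)).1) _).trans h1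
  -- The factor `ρ / (2 (‖X‖ + 1))` shrinks `X` into the hull, where `T + ℓ ≥ 0`. The same bound for
  -- `-X` gives the upper estimate.
  have hlow : ∀ (X : ProjTensor 𝕜 A (E →L[𝕜] E)), adj X = X → ∀ V : N →L[𝕜] E,
      -(2 * (‖X‖ + 1) / ρ * sqNorm T V) ≤ RCLike.re (ℓ (compress V X)) := fun X hX V => by
    have hs : 0 < ρ / (2 * (‖X‖ + 1)) := by positivity
    have h1 := nonneg_of_mem_hull hFpos h V
      (((ρ / (2 * (‖X‖ + 1)) : ℝ) : 𝕜) • X) (hint _ (by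
        rw [map_smulₛₗ, RCLike.conj_ofReal, hX]) (by
        rw [sub_zero, norm_smul, RCLike.norm_ofReal, abs_of_pos hs, div_mul_eq_mul_div,
          div_lt_iff₀ (by positivity)]
        nlinarith [norm_nonneg X]))
    rw [map_smul, ℓ.map_smul, smul_eq_mul, RCLike.re_ofReal_mul] at h1
    rw [neg_le_iff_add_nonneg']
    have h2 := mul_nonneg (inv_pos.2 hs).le h1
    rw [mul_add, inv_mul_cancel_left₀ hs.ne', inv_div] at h2
    exact h2
  have hup : ∀ (X : ProjTensor 𝕜 A (E →L[𝕜] E)), adj X = X → ∀ V : N →L[𝕜] E,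
      |RCLike.re (ℓ (compress V X))| ≤ 2 * (‖X‖ + 1) / ρ * sqNorm T V := fun X hX V => by
    have h1 := hlow (-X) (by rw [map_neg, hX]) V
    rw [norm_neg, map_neg, map_neg, map_neg, neg_le_neg_iff] at h1
    exact abs_le.2 ⟨hlow X hX V, h1⟩
  refine ⟨1 + k + 2 / ρ, fun Y X hY hX W V => ?_⟩
  refine norm_sq_le_of_abs_diag_le
    (fun W V : N →L[𝕜] E => form W V (pencil T v (dualMap ℓ) E (Y, X))) (sqNorm T) _
    (fun W V V' => form_add_right W V V' _) (fun W c V => form_smul_right W V c _)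
    (form_pencil_hermitian T hT v ℓ hℓ Y hY X hX) (sqNorm_add_add_sqNorm_sub T)
    (sqNorm_smul T) (fun V => ?_) W V
  rw [form_pencil_dualMap, map_add, map_sub]
  change |sqNorm T V - _ + RCLike.re (ℓ (compress V X))| ≤ _
  have h1 : |RCLike.re (inner 𝕜 (V v) (Y (V v)) : 𝕜)| ≤ ‖Y‖ * (k * sqNorm T V) := by
    refine (RCLike.abs_re_le_norm _).trans ((norm_inner_le_norm _ _).trans ?_)
    have h2 := mul_le_mul_of_nonneg_left (Y.le_opNorm (V v)) (norm_nonneg (V v))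
    have h3 := mul_le_mul_of_nonneg_left (hvT V) (norm_nonneg Y)
    nlinarith
  have h2 := hup X hX V
  refine (abs_add_le _ _).trans ((add_le_add (abs_sub _ _) le_rfl).trans ?_)
  rw [abs_of_nonneg (hS V)]
  refine (add_le_add (add_le_add le_rfl h1) h2).trans ?_
  rw [show sqNorm T V + ‖Y‖ * (k * sqNorm T V) + 2 * (‖X‖ + 1) / ρ * sqNorm T V
    = (1 + ‖Y‖ * k + 2 / ρ * (‖X‖ + 1)) * sqNorm T V by ring]
  refine mul_le_mul_of_nonneg_right ?_ (hS V)
  have hr : 0 ≤ 2 / ρ := by positivity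
  have := norm_nonneg X
  have := norm_nonneg Y
  nlinarith [mul_nonneg hk0 (norm_nonneg X), mul_nonneg hr (norm_nonneg Y)]

theorem isSelfAdjointMap_dualMap (ℓ : StrongDual 𝕜 (ProjTensor 𝕜 A (N →L[𝕜] N)))
    (hℓ : ∀ X, ℓ (adj X) = conj (ℓ X)) : IsSelfAdjointMap (dualMap ℓ) := fun x Z => by
  have h := hℓ (tmulL 𝕜 A (N →L[𝕜] N) x (star Z))
  rw [adj_tmul, star_star] at h
  exact h

theorem adjoint_one_comp_one : (1 : N →L[𝕜] N).adjoint ∘L (1 : N →L[𝕜] N) = 1 := by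
  rw [← ContinuousLinearMap.star_eq_adjoint, star_one]; rfl

theorem form_pencil_eq_zero (T : OpDual 𝕜 N) (v : N)
    (ℓ : StrongDual 𝕜 (ProjTensor 𝕜 A (N →L[𝕜] N))) (Y : N →L[𝕜] N)
    (a : ProjTensor 𝕜 A (N →L[𝕜] N)) (hsum : T 1 + ℓ a = inner 𝕜 v (Y v)) :
    form 1 1 (pencil T v (dualMap ℓ) N (Y, a)) = 0 := by
  rw [form_pencil_dualMap, adjoint_one_comp_one]
  change T 1 - inner 𝕜 v (Y v) + ℓ (compress 1 a) = 0
  rw [compress_one, ← hsum]; ring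

/-- Domination at `V = 1` reads `⟨v, Y v⟩ ≤ T(1) + (1 + ε) ℓ(a) = t + ε ℓ(a)`, in real parts. -/
theorem neg_re_le_div
    (h : Dominates D F v T ℓ)
    (t : 𝕜) (a : ProjTensor 𝕜 A (N →L[𝕜] N)) (hsum : T 1 + ℓ a = t) (ε : ℝ) (hε : 0 < ε)
    (Y : N →L[𝕜] N) (hY : (Y, ((1 + ε : ℝ) : 𝕜) • a) ∈ hypoHull D F N) :
    -RCLike.re (ℓ a) ≤ (RCLike.re t - RCLike.re (inner 𝕜 v (Y v) : 𝕜)) / ε := by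
  have h1 := re_inner_le_of_mem_hypoHull h 1 Y _ hY
  rw [adjoint_one_comp_one, compress_one, ℓ.map_smul, smul_eq_mul, RCLike.re_ofReal_mul] at h1
  change RCLike.re (inner 𝕜 v (Y v) : 𝕜) ≤ _ at h1
  rw [← hsum, map_add, le_div_iff₀ hε]
  linarith

theorem isNonneg_pencil (hDsa : IsSelfAdjointFamily D) (hFpos : IsPositiveOn D F)
    (hT : ∀ Z, T (star Z) = conj (T Z)) (hℓ : ∀ X, ℓ (adj X) = conj (ℓ X))
    (h : Dominates D F v T ℓ)
    {E : Type u} [NormedAddCommGroup E] [InnerProductSpace 𝕜 E] [CompleteSpace E]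
    (p : (E →L[𝕜] E) × ProjTensor 𝕜 A (E →L[𝕜] E)) (hp : p ∈ hypo D F E) :
    IsNonneg (pencil T v (dualMap ℓ) E p) := by
  obtain ⟨Y, X⟩ := p
  -- `Y = F(X) - (F(X) - Y)` is a difference of positive operators.
  have hY : IsSelfAdjoint Y := by
    have h1 := ContinuousLinearMap.IsPositive.isSelfAdjoint hp.2
    have h2 := ((ContinuousLinearMap.nonneg_iff_isPositive _).1 (hFpos E X hp.1).1).isSelfAdjoint
    have h3 := h2.sub h1
    rwa [sub_sub_cancel] at h3
  refine ⟨form_pencil_hermitian T hT v ℓ hℓ Y hY X (hDsa E X hp.1), fun V => ?_⟩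
  have h1 := h E V Y X hp
  rw [form_pencil_dualMap, map_add, map_sub]
  change 0 ≤ _ - _ + RCLike.re (ℓ (compress V X))
  linarith

end Estimates

end SepPencil

end

/-! ### The separating pencil -/

theorem propositionP {𝕜 : Type*} [RCLike 𝕜]
    {A : Type w} [NormedAddCommGroup A] [NormedSpace 𝕜 A] [CompleteSpace A]
    [StarAddMonoid A] [StarModule 𝕜 A] [ContinuousStar A]
    (D : SepPencil.SetFamily.{u} 𝕜 A) (F : SepPencil.FunFamily.{u} 𝕜 A)
    (hDsa : SepPencil.IsSelfAdjointFamily D)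
    (hDsum : SepPencil.ClosedUnderSums D)
    (hFsum : SepPencil.PreservesSums D F)
    (hFjensen : SepPencil.IsJensen D F)
    (hD0 : ∀ (E : Type u) [NormedAddCommGroup E] [InnerProductSpace 𝕜 E] [CompleteSpace E],
      (0 : SepPencil.ProjTensor 𝕜 A (E →L[𝕜] E)) ∈ D E)
    (hFpos : SepPencil.IsPositiveOn D F)
    (hDint : ∀ (E : Type u) [NormedAddCommGroup E] [InnerProductSpace 𝕜 E] [CompleteSpace E],
      (SepPencil.saInterior (SepPencil.hull D E)).Nonempty)
    (N : Type u) [NormedAddCommGroup N] [InnerProductSpace 𝕜 N] [CompleteSpace N]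
    (a : SepPencil.ProjTensor 𝕜 A (N →L[𝕜] N)) (ha : a ∈ D N)
    (haint : a ∈ SepPencil.saInterior (SepPencil.hull D N))
    (v : N) (hv : ‖v‖ = 1) :
    ∃ (T : SepPencil.OpDual 𝕜 N) (Λ : A →L[𝕜] SepPencil.OpDual 𝕜 N),
      SepPencil.IsPositiveFunctional T ∧
      SepPencil.IsSelfAdjointMap Λ ∧
      SepPencil.IsCompletelyBounded Λ ∧
      SepPencil.IsCompletelyBoundedAffine
        (fun (E : Type u) [NormedAddCommGroup E] [InnerProductSpace 𝕜 E] [CompleteSpace E] =>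
          SepPencil.pencil T v Λ E) ∧
      -- (a)
      (T 1 = inner 𝕜 v (F N a v)
          - SepPencil.form 1 1 (SepPencil.amplify Λ N a) ∧
        (∃ ε : ℝ, 0 < ε ∧ ((1 + ε : ℝ) : 𝕜) • a ∈ SepPencil.hull D N) ∧
        ∀ ε : ℝ, 0 < ε → ((1 + ε : ℝ) : 𝕜) • a ∈ SepPencil.hull D N →
          ∀ Y : N →L[𝕜] N, (Y, ((1 + ε : ℝ) : 𝕜) • a) ∈ SepPencil.hypoHull D F N →
            -RCLike.re (SepPencil.form 1 1 (SepPencil.amplify Λ N a))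
              ≤ (RCLike.re (inner 𝕜 v (F N a v)) - RCLike.re (inner 𝕜 v (Y v))) / ε) ∧
      -- (b)
      (∀ (E : Type u) [NormedAddCommGroup E] [InnerProductSpace 𝕜 E] [CompleteSpace E],
        ∀ p ∈ SepPencil.hypo D F E, SepPencil.IsNonneg (SepPencil.pencil T v Λ E p)) ∧
      -- (c)
      SepPencil.form 1 1 (SepPencil.pencil T v Λ N (F N a, a)) = 0 ∧
      -- (d)
      (∀ (E : Type u) [NormedAddCommGroup E] [InnerProductSpace 𝕜 E] [CompleteSpace E],
        ∀ X ∈ SepPencil.saInterior (SepPencil.hull D E), ∃ ε : ℝ, 0 < ε ∧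
          ∀ V : N →L[𝕜] E,
            ε * SepPencil.sqNorm T V
              ≤ RCLike.re (SepPencil.form V V (SepPencil.pencil T v Λ E (0, X)))) ∧
      -- boundedness with respect to the semi-inner product of `T`
      (∀ (E : Type u) [NormedAddCommGroup E] [InnerProductSpace 𝕜 E] [CompleteSpace E],
        0 ∈ SepPencil.saInterior (SepPencil.hull D E) →
          ∃ C : ℝ, ∀ (Y : E →L[𝕜] E) (X : SepPencil.ProjTensor 𝕜 A (E →L[𝕜] E)),
            IsSelfAdjoint Y → SepPencil.adj X = X → ∀ W V : N →L[𝕜] E,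
              ‖SepPencil.form W V (SepPencil.pencil T v Λ E (Y, X))‖ ^ 2
                ≤ (C * (1 + ‖Y‖ + ‖X‖)) ^ 2
                  * (SepPencil.sqNorm T W * SepPencil.sqNorm T V)) := by
  obtain ⟨T, ℓ, hT, hℓ, hsum, h⟩ := SepPencil.exists_supporting_functionals hDsa hDsum hFsum
    hFjensen hD0 hFpos a ha haint v hv
  have hone : SepPencil.form 1 1 (SepPencil.amplify (SepPencil.dualMap ℓ) N a) = ℓ a :=
    (SepPencil.form_amplify_dualMap ℓ 1 1 a).trans (congrArg ℓ (SepPencil.compress_one a))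
  refine ⟨T, SepPencil.dualMap ℓ, hT, SepPencil.isSelfAdjointMap_dualMap ℓ hℓ,
    SepPencil.isCompletelyBounded _, SepPencil.isCompletelyBoundedAffine_pencil _ _ _, ⟨?_, ?_, ?_⟩, ?_, ?_, ?_, ?_⟩
  · rw [hone, ← hsum, add_sub_cancel_right]
  · obtain ⟨ε, ρ, hε, hρ, hint⟩ := SepPencil.exists_add_mem_of_mem_saInterior haint
    have h1 := hint 0 (map_zero _) (by rwa [norm_zero])
    rw [add_zero] at h1
    exact ⟨ε, hε, h1⟩
  · intro ε hε _ Y hY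
    rw [hone]
    exact SepPencil.neg_re_le_div h _ a hsum ε hε Y hY
  · intro E _ _ _ p hp
    exact SepPencil.isNonneg_pencil hDsa hFpos hT.1 hℓ h p hp
  · exact SepPencil.form_pencil_eq_zero T v ℓ _ a hsum
  · intro E _ _ _ X hX
    exact SepPencil.exists_mul_sqNorm_le hFpos h X hX
  · intro E _ _ _ h0
    exact SepPencil.exists_norm_form_sq_le hFpos hD0 hT.1 hℓ h E h0
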